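/- Let $\mathbb F$ be an algebraically closed field of characteristic $p>2$, let $n\ge 3$ and let $\underline t=(t_1,\dots,t_n)$ be positive integers. Let $\Lambda(n,n)$ be the tensor product of the divided power algebra in the even variables $x_1,\dots,x_n$ and the Grassmann algebra in the odd variables $x_{n+1},\dots,x_{2n}$, with superderivations $D_1,\dots,D_{2n}$ (the partial derivatives) of parity $\tau(i)=\bar 0$ for $i\le n$ and $\tau(i)=\bar 1$ for $i>n$. Let $\Lambda(n,n;\underline t)$ be the subalgebra spanned by the monomials $x^{(\alpha)}x^u$ with $0\le\alpha_i\le p^{t_i}-1$, and let $W(n,n;\underline t)=\{\sum_i f_iD_i\mid f_i\in\Lambda(n,n;\underline t)\}$ be the Lie superalgebra with bracket $[fD_i,gD_j]=fD_i(g)D_j-(-1)^{d(fD_i)d(gD_j)}gD_j(f)D_i$. Put $i'=i+n$ for $i\le n$ and $i'=i-n$ for $i>n$; let $T_H(f)=\sum_{i=1}^{2n}(-1)^{\tau(i)d(f)}D_i(f)D_{i'}$ and $HO=\{T_H(f)\mid f\in\Lambda(n,n;\underline t)\}$; let $\mathrm{div}(\sum_i f_iD_i)=\sum_i(-1)^{\tau(i)d(f_i)}D_i(f_i)$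 and $S'=\{X\in W(n,n;\underline t)\mid \mathrm{div}(X)=0\}$. With $SHO'=S'\cap HO$ and $\overline{SHO}=[SHO',SHO']$, let $SHO=SHO(n,n;\underline t)=[\overline{SHO},\overline{SHO}]$ be the special odd Hamiltonian superalgebra. A bilinear map $\phi$ on a Lie superalgebra $L=L_{\bar 0}\oplus L_{\bar 1}$ is $\mathbb Z_2$-homogeneous of degree $\gamma$ if $\phi(L_\alpha,L_\beta)\subseteq L_{\alpha+\beta+\gamma}$ for all $\alpha,\beta\in\mathbb Z_2$, and even if it is so with $\gamma=\bar 0$. A homogeneous skew-symmetric super-biderivation of degree $\gamma$ is a homogeneous bilinear map $\phi:L\times L\to L$ of degree $\gamma$ with $$\phi(x,[y,z])=[\phi(x,y),z]+(-1)^{(\gamma+d(x))d(y)}[y,\phi(x,z)],\qquad \phi(x,y)=-(-1)^{\gamma d(x)+\gamma d(y)+d(x)d(y)}\phi(y,x)$$ for all homogeneous $x,y,z\in L$. These form a space $\mathrm{BDer}_\gamma(L)$, and a skew-symmetric super-biderivation is an element of $\mathrm{BDer}(L)=\mathrm{BDer}_{\bar 0}(L)\oplus\mathrm{BDer}_{\bar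 1}(L)$. Then every $\mathbb Z_2$-homogeneous skew-symmetric super-biderivation of $SHO$ is even, and every skew-symmetric super-biderivation of $SHO$ is $\mathbb Z_2$-homogeneous and, further, even. -/

import Mathlib

/-! # The special odd Hamiltonian Lie superalgebra `SHO(n,n;t)` and its skew-symmetric
super-biderivations -/

noncomputable section

namespace OddHam

/-! ## Signs and indices -/

/-- The sign `(-1)^a` for `a` in `ℤ/2`. -/
def sgn (F : Type*) [Field F] (a : ZMod 2) : F := if a = 0 then 1 else -1

/-- The index set `Y = Y₀ ∪ Y₁`: `inl i` stands for `i ∈ {1,…,n}` and `inr i` for the index `n + i`. -/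
abbrev Idx (n : ℕ) := Fin n ⊕ Fin n

/-- The parity `τ(i)` of an index. -/
def tau {n : ℕ} : Idx n → ZMod 2 := Sum.elim (fun _ => 0) (fun _ => 1)

/-- The involution `i ↦ i'` exchanging `i` and `n + i`. -/
def bar {n : ℕ} : Idx n → Idx n := Sum.swap

/-! ## The associative superalgebra `Λ(n,n) = U(n) ⊗ Λ(n)`, in its monomial basis -/

/-- The pair `(α, u)` indexes the monomial `x^(α) x^u`; the set `u` lists the odd variables
`x_{n+i}`, `i ∈ u`, which are multiplied in increasing order. -/
abbrev Mon (n : ℕ) := (Fin n → ℕ) × Finset (Fin n)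

/-- The space with basis all `x^(α) x^u`, i.e. the tensor product of the divided power algebra in
`n` even variables and the Grassmann algebra in `n` odd variables. -/
abbrev Lam (F : Type*) [Field F] (n : ℕ) := Mon n →₀ F

/-- The `ℤ/2`-degree `|u|` of a monomial. -/
def monDeg {n : ℕ} (m : Mon n) : ZMod 2 := (m.2.card : ZMod 2)

/-- The number of transpositions needed to sort the concatenation of `u` and `v`. -/
def inversions {n : ℕ} (u v : Finset (Fin n)) : ℕ := ∑ a ∈ u, (v.filter (fun b => b < a)).card

/-- The product of two monomials,
`x^(α) x^u · x^(β) x^v = binom(α+β, α) x^(α+β) (x^u x^v)`. -/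
def monMul (F : Type*) [Field F] {n : ℕ} (m k : Mon n) : Lam F n :=
  if Disjoint m.2 k.2 then
    Finsupp.single (m.1 + k.1, m.2 ∪ k.2)
      ((-1) ^ inversions m.2 k.2 * ∏ i, ((m.1 i + k.1 i).choose (m.1 i) : F))
  else 0

/-- The product of `Λ(n,n)`. -/
def mul (F : Type*) [Field F] (n : ℕ) : Lam F n →ₗ[F] Lam F n →ₗ[F] Lam F n :=
  Finsupp.linearCombination F fun m => Finsupp.linearCombination F fun k => monMul F m k

/-- The value of `D_i` on a monomial: lowering of the divided power for even `i`, the left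
derivative of the Grassmann monomial for odd `i`. -/
def monD (F : Type*) [Field F] {n : ℕ} (i : Idx n) (m : Mon n) : Lam F n :=
  match i with
  | Sum.inl i => if m.1 i = 0 then 0 else Finsupp.single (m.1 - Pi.single i 1, m.2) 1
  | Sum.inr i =>
      if i ∈ m.2 then
        Finsupp.single (m.1, m.2.erase i) ((-1) ^ (m.2.filter (fun b => b < i)).card)
      else 0

/-- The superderivations `D_1, …, D_{2n}` of `Λ(n,n)`. -/
def D (F : Type*) [Field F] {n : ℕ} (i : Idx n) : Lam F n →ₗ[F] Lam F n :=
  Finsupp.linearCombination F (monD F i)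

/-- The projection of `Λ(n,n)` onto its component of `ℤ/2`-degree `a`. -/
def proj (F : Type*) [Field F] (n : ℕ) (a : ZMod 2) : Lam F n →ₗ[F] Lam F n :=
  Finsupp.linearCombination F fun m => if monDeg m = a then Finsupp.single m 1 else 0

/-- The component of `Λ(n,n)` of `ℤ/2`-degree `a`. -/
def lamPart (F : Type*) [Field F] (n : ℕ) (a : ZMod 2) : Submodule F (Lam F n) :=
  Submodule.span F {f | ∃ m : Mon n, monDeg m = a ∧ f = Finsupp.single m 1}

/-- The subalgebra `Λ(n,n;t)`, spanned by the `x^(α) x^u` with `α_i ≤ p^{t_i} - 1`. -/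
def lamT (F : Type*) [Field F] (n p : ℕ) (t : Fin n → ℕ) : Submodule F (Lam F n) :=
  Submodule.span F {f | ∃ m : Mon n, (∀ i, m.1 i < p ^ t i) ∧ f = Finsupp.single m 1}

/-! ## The Lie superalgebra `W(n,n)` -/

/-- The space of all `∑ f_i D_i`; such an element is given by its coefficients `f_i`. -/
abbrev Wit (F : Type*) [Field F] (n : ℕ) := Idx n → Lam F n

/-- The action of `∑ f_i D_i` on `Λ(n,n)`: `g ↦ ∑ f_i D_i(g)`. -/
def act (F : Type*) [Field F] (n : ℕ) : Wit F n →ₗ[F] Lam F n →ₗ[F] Lam F n :=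
  ∑ i, (mul F n).compl₁₂ (LinearMap.proj i) (D F i)

/-- The component of `W(n,n)` of `ℤ/2`-degree `a`; the degree of `f D_i` is `d(f) + τ(i)`. -/
def witPart (F : Type*) [Field F] (n : ℕ) (a : ZMod 2) : Submodule F (Wit F n) :=
  Submodule.pi Set.univ fun i => lamPart F n (a + tau i)

/-- The projection of `W(n,n)` onto its component of `ℤ/2`-degree `a`. -/
def witProj (F : Type*) [Field F] (n : ℕ) (a : ZMod 2) : Wit F n →ₗ[F] Wit F n :=
  LinearMap.pi fun i => proj F n (a + tau i) ∘ₗ LinearMap.proj i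

/-- For `X = ∑ f_i D_i` and `Y = ∑ g_j D_j`, the element `X ∘ Y := ∑_{i,j} f_i D_i(g_j) D_j`. -/
def comp (F : Type*) [Field F] (n : ℕ) : Wit F n →ₗ[F] Wit F n →ₗ[F] Wit F n :=
  LinearMap.mk₂ F (fun X Y j => act F n X (Y j))
    (fun X X' Y => by ext1 j; simp)
    (fun c X Y => by ext1 j; simp)
    (fun X Y Y' => by ext1 j; simp)
    (fun c X Y => by ext1 j; simp)

/-- The bracket of `W(n,n)`: the bilinear map whose value on elements `X`, `Y` of `ℤ/2`-degrees
`a`, `b` is `X ∘ Y - (-1)^{ab} Y ∘ X`, so that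
`[f D_i, g D_j] = f D_i(g) D_j - (-1)^{d(f D_i) d(g D_j)} g D_j(f) D_i`. -/
def bracket (F : Type*) [Field F] (n : ℕ) : Wit F n →ₗ[F] Wit F n →ₗ[F] Wit F n :=
  LinearMap.mk₂ F
    (fun X Y => ∑ a : ZMod 2, ∑ b : ZMod 2,
      (comp F n (witProj F n a X) (witProj F n b Y) -
        sgn F (a * b) • comp F n (witProj F n b Y) (witProj F n a X)))
    (fun X X' Y => by
      simp only [← Finset.sum_add_distrib]
      refine Finset.sum_congr rfl fun a _ => Finset.sum_congr rfl fun b _ => ?_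
      simp only [map_add, LinearMap.add_apply, smul_add]; abel)
    (fun c X Y => by
      simp only [Finset.smul_sum]
      refine Finset.sum_congr rfl fun a _ => Finset.sum_congr rfl fun b _ => ?_
      simp only [map_smul, LinearMap.smul_apply, smul_sub, smul_comm c])
    (fun X Y Y' => by
      simp only [← Finset.sum_add_distrib]
      refine Finset.sum_congr rfl fun a _ => Finset.sum_congr rfl fun b _ => ?_
      simp only [map_add, LinearMap.add_apply, smul_add]; abel)
    (fun c X Y => by
      simp only [Finset.smul_sum]
      refine Finset.sum_congr rfl fun a _ => Finset.sum_congr rfl fun b _ => ?_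
      simp only [map_smul, LinearMap.smul_apply, smul_sub, smul_comm c])

/-- The span `[M, N]` of all brackets of elements of two subspaces. -/
def brk {F : Type*} [Field F] {n : ℕ} (M N : Submodule F (Wit F n)) : Submodule F (Wit F n) :=
  Submodule.span F {Z | ∃ X ∈ M, ∃ Y ∈ N, Z = bracket F n X Y}

/-- `W(n,n;t)`. -/
def witT (F : Type*) [Field F] (n p : ℕ) (t : Fin n → ℕ) : Submodule F (Wit F n) :=
  Submodule.pi Set.univ fun _ => lamT F n p t

/-! ## Odd Hamiltonian and divergence-free elements -/

/-- `T_H(f) = ∑_i (-1)^{τ(i) d(f)} D_i(f) D_{i'}`; the coefficient of `D_j` is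
`(-1)^{τ(j') d(f)} D_{j'}(f)`. -/
def TH (F : Type*) [Field F] (n : ℕ) : Lam F n →ₗ[F] Wit F n :=
  LinearMap.pi fun j => ∑ a : ZMod 2, sgn F (tau (bar j) * a) • (D F (bar j) ∘ₗ proj F n a)

/-- The divergence, `f_i D_i ↦ (-1)^{τ(i) d(f_i)} D_i(f_i)`. -/
def dvg (F : Type*) [Field F] (n : ℕ) : Wit F n →ₗ[F] Lam F n :=
  ∑ i : Idx n, ∑ a : ZMod 2,
    sgn F (tau i * a) • (D F i ∘ₗ proj F n a ∘ₗ LinearMap.proj i)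

/-- `HO(n,n;t)`. -/
def HO (F : Type*) [Field F] (n p : ℕ) (t : Fin n → ℕ) : Submodule F (Wit F n) :=
  (lamT F n p t).map (TH F n)

/-- `S'(n,n;t)`. -/
def SPrime (F : Type*) [Field F] (n p : ℕ) (t : Fin n → ℕ) : Submodule F (Wit F n) :=
  witT F n p t ⊓ LinearMap.ker (dvg F n)

/-- `SHO'(n,n;t) = S'(n,n;t) ∩ HO(n,n;t)`. -/
def SHOPrime (F : Type*) [Field F] (n p : ℕ) (t : Fin n → ℕ) : Submodule F (Wit F n) :=
  SPrime F n p t ⊓ HO F n p t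

/-- The derived algebra of `SHO'(n,n;t)`. -/
def SHOBar (F : Type*) [Field F] (n p : ℕ) (t : Fin n → ℕ) : Submodule F (Wit F n) :=
  brk (SHOPrime F n p t) (SHOPrime F n p t)

/-- The special odd Hamiltonian superalgebra `SHO(n,n;t)`: the second derived algebra of
`SHO'(n,n;t)`. -/
def SHO (F : Type*) [Field F] (n p : ℕ) (t : Fin n → ℕ) : Submodule F (Wit F n) :=
  brk (SHOBar F n p t) (SHOBar F n p t)

/-! ## `SHO(n,n;t)` is closed under the bracket -/

section closure

variable {F : Type*} [Field F] {n : ℕ}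

theorem sgn_zero : sgn F 0 = 1 := by simp [sgn]
theorem sgn_one : sgn F 1 = -1 := by simp [sgn]

theorem sgn_add (a b : ZMod 2) : sgn F (a + b) = sgn F a * sgn F b := by
  have h : (1 + 1 : ZMod 2) = 0 := by decide
  have hc : ∀ a : ZMod 2, a = 0 ∨ a = 1 := by decide
  rcases hc a with rfl | rfl <;> rcases hc b with rfl | rfl <;> simp [sgn, h]

theorem sgn_natCast (k : ℕ) : sgn F (k : ZMod 2) = (-1) ^ k := by
  induction k with
  | zero => simp [sgn]
  | succ k ih => push_cast; rw [sgn_add, ih, sgn_one, pow_succ]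

theorem mul_single (m k : Mon n) (c d : F) :
    mul F n (Finsupp.single m c) (Finsupp.single k d) = (c * d) • monMul F m k := by
  simp [mul, Finsupp.linearCombination_single, mul_smul]

theorem D_single (i : Idx n) (m : Mon n) (c : F) :
    D F i (Finsupp.single m c) = c • monD F i m := by
  simp [D, Finsupp.linearCombination_single]

theorem proj_single (a : ZMod 2) (m : Mon n) (c : F) :
    proj F n a (Finsupp.single m c) = if monDeg m = a then Finsupp.single m c else 0 := by
  simp only [proj, Finsupp.linearCombination_single]
  split_ifs <;> simp

theorem act_apply (X : Wit F n) (g : Lam F n) :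
    act F n X g = ∑ i, mul F n (X i) (D F i g) := by
  simp [act, LinearMap.sum_apply]

theorem comp_apply (X Y : Wit F n) (j : Idx n) : comp F n X Y j = act F n X (Y j) := rfl

theorem single_mem_part (m : Mon n) (c : F) (a : ZMod 2) (h : monDeg m = a) :
    Finsupp.single m c ∈ lamPart F n a := by
  have : Finsupp.single m c = c • (Finsupp.single m 1 : Lam F n) := by simp
  rw [this]
  exact Submodule.smul_mem _ _ (Submodule.subset_span ⟨m, h, rfl⟩)

theorem proj_mem (a : ZMod 2) (f : Lam F n) : proj F n a f ∈ lamPart F n a := by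
  induction f using Finsupp.induction_linear with
  | zero => simp
  | add f g hf hg => rw [map_add]; exact Submodule.add_mem _ hf hg
  | single m c =>
    rw [proj_single]
    split_ifs with h
    · exact single_mem_part m c a h
    · simp

theorem proj_of_mem {a : ZMod 2} {f : Lam F n} (hf : f ∈ lamPart F n a) (b : ZMod 2) :
    proj F n b f = if b = a then f else 0 := by
  induction hf using Submodule.span_induction with
  | mem f h =>
    obtain ⟨m, rfl, rfl⟩ := h
    rw [proj_single]
    simp [eq_comm]
  | zero => simp
  | add f g _ _ hf hg => rw [map_add, hf, hg]; split_ifs <;> simp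
  | smul c f _ hf => rw [map_smul, hf]; split_ifs <;> simp

theorem sum_proj (f : Lam F n) : ∑ a : ZMod 2, proj F n a f = f := by
  induction f using Finsupp.induction_linear with
  | zero => simp
  | add f g hf hg => simp only [map_add, Finset.sum_add_distrib, hf, hg]
  | single m c => simp [proj_single]

theorem witProj_apply (a : ZMod 2) (X : Wit F n) (i : Idx n) :
    witProj F n a X i = proj F n (a + tau i) (X i) := rfl

theorem witProj_mem (a : ZMod 2) (X : Wit F n) : witProj F n a X ∈ witPart F n a := by
  intro i _
  exact proj_mem _ _

theorem mem_witPart {a : ZMod 2} {X : Wit F n} :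
    X ∈ witPart F n a ↔ ∀ i, X i ∈ lamPart F n (a + tau i) := by
  simp [witPart, Submodule.mem_pi]

/-! Parity of the structure maps -/

theorem monDeg_erase (α : Fin n → ℕ) (u : Finset (Fin n)) (i : Fin n) (h : i ∈ u) :
    monDeg (α, u.erase i) = monDeg (α, u) + 1 := by
  have h2 : (1 + 1 : ZMod 2) = 0 := by decide
  have : u.card = (u.erase i).card + 1 := (Finset.card_erase_add_one h).symm
  simp only [monDeg]
  rw [this]; push_cast; rw [add_assoc, h2, add_zero]

theorem D_mem {a : ZMod 2} {f : Lam F n} (hf : f ∈ lamPart F n a) (i : Idx n) :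
    D F i f ∈ lamPart F n (a + tau i) := by
  induction hf using Submodule.span_induction with
  | mem f h =>
    obtain ⟨m, rfl, rfl⟩ := h
    rw [D_single, one_smul]
    rcases i with i | i
    · simp only [monD, tau, Sum.elim_inl, add_zero]
      split_ifs
      · simp
      · exact single_mem_part _ _ _ rfl
    · simp only [monD, tau, Sum.elim_inr]
      split_ifs with h
      · exact single_mem_part _ _ _ (monDeg_erase _ _ _ h)
      · simp
  | zero => simp
  | add f g _ _ hf hg => rw [map_add]; exact Submodule.add_mem _ hf hg
  | smul c f _ hf => rw [map_smul]; exact Submodule.smul_mem _ _ hf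

theorem mul_mem {a b : ZMod 2} {f g : Lam F n} (hf : f ∈ lamPart F n a)
    (hg : g ∈ lamPart F n b) : mul F n f g ∈ lamPart F n (a + b) := by
  induction hf using Submodule.span_induction with
  | mem f h =>
    obtain ⟨m, rfl, rfl⟩ := h
    induction hg using Submodule.span_induction with
    | mem g h =>
      obtain ⟨k, rfl, rfl⟩ := h
      rw [mul_single]
      refine Submodule.smul_mem _ _ ?_
      simp only [monMul]
      split_ifs with h
      · refine single_mem_part _ _ _ ?_
        simp [monDeg, Finset.card_union_of_disjoint h]
      · simp
    | zero => simp
    | add f g _ _ hf hg => rw [map_add]; exact Submodule.add_mem _ hf hg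
    | smul c f _ hf => rw [map_smul]; exact Submodule.smul_mem _ _ hf
  | zero => simp
  | add f g _ _ hf hg =>
    rw [map_add, LinearMap.add_apply]; exact Submodule.add_mem _ hf hg
  | smul c f _ hf =>
    rw [map_smul, LinearMap.smul_apply]; exact Submodule.smul_mem _ _ hf

/-! Leibniz rule, supercommutativity, and commutation of the derivations -/

theorem inversions_swap (u v : Finset (Fin n)) (h : Disjoint u v) :
    inversions u v + inversions v u = u.card * v.card := by
  have e1 : ∀ u v : Finset (Fin n),
      inversions u v = ∑ a ∈ u, ∑ b ∈ v, if b < a then 1 else 0 := by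
    intro u v
    simp only [inversions, Finset.card_filter]
  rw [e1, e1, Finset.sum_comm (s := v), ← Finset.sum_add_distrib]
  have : ∀ a ∈ u, ((∑ b ∈ v, if b < a then 1 else 0) + ∑ b ∈ v, if a < b then 1 else 0) =
      v.card := by
    intro a ha
    rw [← Finset.sum_add_distrib, Finset.card_eq_sum_ones]
    refine Finset.sum_congr rfl fun b hb => ?_
    have hne : a ≠ b := fun e => Finset.disjoint_left.1 h ha (e ▸ hb)
    rcases lt_or_gt_of_ne hne with hl | hl
    · simp [hl, not_lt_of_gt hl]
    · simp [hl, not_lt_of_gt hl]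
  rw [Finset.sum_congr rfl this]
  simp

theorem monMul_comm (m k : Mon n) :
    monMul F m k = sgn F (monDeg m * monDeg k) • monMul F k m := by
  simp only [monMul]
  by_cases h : Disjoint m.2 k.2
  · rw [if_pos h, if_pos h.symm, Finsupp.smul_single, add_comm m.1, Finset.union_comm]
    congr 1
    have hp : (∏ i, ((m.1 i + k.1 i).choose (m.1 i) : F)) =
        ∏ i, ((k.1 i + m.1 i).choose (k.1 i) : F) := by
      refine Finset.prod_congr rfl fun i _ => ?_
      rw [add_comm (k.1 i), Nat.choose_symm_add]
    rw [hp, smul_eq_mul, ← mul_assoc]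
    congr 1
    have h1 : sgn F (monDeg m * monDeg k) = (-1) ^ (m.2.card * k.2.card) := by
      rw [← sgn_natCast]; simp [monDeg]
    rw [h1, ← inversions_swap _ _ h, ← pow_add, add_assoc, pow_add _ (inversions m.2 k.2), ← two_mul,
      pow_mul]
    simp
  · rw [if_neg h, if_neg fun h' => h h'.symm, smul_zero]

theorem mul_comm_super {a b : ZMod 2} {f g : Lam F n} (hf : f ∈ lamPart F n a)
    (hg : g ∈ lamPart F n b) : mul F n f g = sgn F (a * b) • mul F n g f := by
  induction hf using Submodule.span_induction with
  | mem f h =>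
    obtain ⟨m, rfl, rfl⟩ := h
    induction hg using Submodule.span_induction with
    | mem g h =>
      obtain ⟨k, rfl, rfl⟩ := h
      rw [mul_single, mul_single, one_mul, one_smul, one_smul]
      exact monMul_comm m k
    | zero => simp
    | add f g _ _ hf hg => simp only [map_add, LinearMap.add_apply, hf, hg, smul_add]
    | smul c f _ hf => simp only [map_smul, LinearMap.smul_apply, hf]; rw [smul_comm]
  | zero => simp
  | add f g _ _ hf hg => simp only [map_add, LinearMap.add_apply, hf, hg, smul_add]
  | smul c f _ hf => simp only [map_smul, LinearMap.smul_apply, hf]; rw [smul_comm]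

theorem prod_choose_even (i : Fin n) (a b : Fin n → ℕ) :
    (∏ j, ((a j + b j).choose (a j) : F)) =
      ((a i + b i).choose (a i) : F) *
        ∏ j ∈ Finset.univ.erase i, ((a j + b j).choose (a j) : F) :=
  (Finset.mul_prod_erase _ _ (Finset.mem_univ i)).symm

theorem leibniz_even (i : Fin n) (m k : Mon n) :
    D F (Sum.inl i) (monMul F m k) =
      mul F n (monD F (Sum.inl i) m) (Finsupp.single k 1) +
        mul F n (Finsupp.single m 1) (monD F (Sum.inl i) k) := by
  obtain ⟨a, u⟩ := m
  obtain ⟨b, v⟩ := k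
  by_cases h : Disjoint u v
  swap
  · have h0 : ∀ a b : Fin n → ℕ, monMul F (a, u) (b, v) = 0 := fun a b => by simp [monMul, h]
    simp only [monD]
    split_ifs <;> simp [mul_single, h0]
  have hm : ∀ a b : Fin n → ℕ, monMul F (a, u) (b, v) =
      Finsupp.single (a + b, u ∪ v)
        ((-1) ^ inversions u v * ∏ i, ((a i + b i).choose (a i) : F)) := fun a b => by
    simp [monMul, h]
  have key : ∀ c : Fin n → ℕ, (∏ j ∈ Finset.univ.erase i, ((c j + b j).choose (c j) : F)) =
      ∏ j ∈ Finset.univ.erase i,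
        (((c - Pi.single i 1 : Fin n → ℕ) j + b j).choose ((c - Pi.single i 1 : Fin n → ℕ) j) : F) := by
    intro c
    refine Finset.prod_congr rfl fun j hj => ?_
    have : j ≠ i := (Finset.mem_erase.1 hj).1
    simp [Pi.single_eq_of_ne this]
  have key' : ∀ c : Fin n → ℕ, (∏ j ∈ Finset.univ.erase i, ((a j + c j).choose (a j) : F)) =
      ∏ j ∈ Finset.univ.erase i,
        ((a j + (c - Pi.single i 1 : Fin n → ℕ) j).choose (a j) : F) := by
    intro c
    refine Finset.prod_congr rfl fun j hj => ?_
    have : j ≠ i := (Finset.mem_erase.1 hj).1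
    simp [Pi.single_eq_of_ne this]
  have e1 : a i ≠ 0 → a - Pi.single i 1 + b = a + b - Pi.single i 1 := by
    intro ha
    funext j
    by_cases hj : j = i
    · subst hj; simp; omega
    · simp [Pi.single_eq_of_ne hj]
  have e2 : b i ≠ 0 → a + (b - Pi.single i 1) = a + b - Pi.single i 1 := by
    intro ha
    funext j
    by_cases hj : j = i
    · subst hj; simp; omega
    · simp [Pi.single_eq_of_ne hj]
  rw [hm, D_single, prod_choose_even i]
  simp only [monD, Pi.add_apply]
  by_cases ha : a i = 0
  · by_cases hb : b i = 0
    · simp [ha, hb]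
    · simp only [ha, hb, if_true, if_false, map_zero, LinearMap.zero_apply, zero_add]
      rw [mul_single, hm, prod_choose_even i, key' b, e2 hb]
      simp [ha]
  · by_cases hb : b i = 0
    · simp only [ha, hb, if_true, if_false, map_zero, add_zero]
      rw [mul_single, hm, prod_choose_even i, key a, e1 ha]
      simp [hb]
    · have hab : a i + b i ≠ 0 := by omega
      rw [if_neg hab, if_neg ha, if_neg hb, mul_single, mul_single, hm, hm, prod_choose_even i,
        prod_choose_even i a, e1 ha, e2 hb, ← key, ← key']
      simp only [mul_one, one_smul, Finsupp.smul_single, smul_eq_mul]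
      rw [← Finsupp.single_add]
      congr 1
      obtain ⟨x, hx⟩ := Nat.exists_eq_succ_of_ne_zero ha
      obtain ⟨y, hy⟩ := Nat.exists_eq_succ_of_ne_zero hb
      have hc : ((a i + b i).choose (a i) : F) =
          (((a i - 1) + b i).choose (a i - 1) : F) + ((a i + (b i - 1)).choose (a i) : F) := by
        rw [hx, hy]
        simp only [Nat.succ_eq_add_one, Nat.add_sub_cancel]
        rw [← Nat.cast_add, show x + 1 + (y + 1) = (x + 1 + y) + 1 by ring,
          Nat.choose_succ_succ, show x + (y + 1) = x + 1 + y by ring]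
      simp only [Pi.sub_apply, Pi.single_eq_same]
      rw [hc]
      ring

/-- The number of elements of `u` below `i`. -/
def below (u : Finset (Fin n)) (i : Fin n) : ℕ := (u.filter (fun b => b < i)).card

/-- The number of elements of `u` above `i`. -/
def above (u : Finset (Fin n)) (i : Fin n) : ℕ := (u.filter (fun b => i < b)).card

theorem inversions_erase_left (u v : Finset (Fin n)) (i : Fin n) (h : i ∈ u) :
    inversions u v = inversions (u.erase i) v + below v i := by
  simp only [inversions, below]
  rw [← Finset.add_sum_erase _ _ h, add_comm]

theorem inversions_erase_right (u v : Finset (Fin n)) (i : Fin n) (h : i ∈ v) :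
    inversions u v = inversions u (v.erase i) + above u i := by
  simp only [inversions, above]
  rw [Finset.card_filter, ← Finset.sum_add_distrib]
  refine Finset.sum_congr rfl fun a _ => ?_
  simp only [Finset.card_filter]
  rw [← Finset.add_sum_erase _ _ h, add_comm]

theorem below_union (u v : Finset (Fin n)) (i : Fin n) (h : Disjoint u v) :
    below (u ∪ v) i = below u i + below v i := by
  simp only [below, Finset.filter_union]
  exact Finset.card_union_of_disjoint (Finset.disjoint_filter_filter h)

theorem above_add_below (u : Finset (Fin n)) (i : Fin n) (h : i ∉ u) :
    above u i + below u i = u.card := by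
  simp only [above, below]
  rw [← Finset.card_union_of_disjoint]
  · congr 1
    ext a
    simp only [Finset.mem_union, Finset.mem_filter]
    constructor
    · rintro (h | h) <;> exact h.1
    · intro ha
      rcases lt_or_gt_of_ne (fun e : a = i => h (e ▸ ha)) with hl | hl
      · exact Or.inr ⟨ha, hl⟩
      · exact Or.inl ⟨ha, hl⟩
  · rw [Finset.disjoint_filter]
    intro a _ h1 h2
    exact absurd h1 (not_lt_of_gt h2)

theorem below_erase (u : Finset (Fin n)) (i : Fin n) : below (u.erase i) i = below u i := by
  simp only [below]
  congr 1
  ext a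
  simp only [Finset.mem_filter, Finset.mem_erase]
  constructor
  · rintro ⟨⟨_, h⟩, h'⟩; exact ⟨h, h'⟩
  · rintro ⟨h, h'⟩; exact ⟨⟨h'.ne, h⟩, h'⟩

theorem neg_one_pow_eq {x y : ℕ} (h : ∃ z w, x + 2 * z = y + 2 * w) : (-1 : F) ^ x = (-1) ^ y := by
  obtain ⟨z, w, h⟩ := h
  have h1 : (-1 : F) ^ (x + 2 * z) = (-1) ^ x := by rw [pow_add, pow_mul]; simp
  have h2 : (-1 : F) ^ (y + 2 * w) = (-1) ^ y := by rw [pow_add, pow_mul]; simp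
  rw [← h1, ← h2, h]

theorem leibniz_odd (i : Fin n) (m k : Mon n) :
    D F (Sum.inr i) (monMul F m k) =
      mul F n (monD F (Sum.inr i) m) (Finsupp.single k 1) +
        (-1 : F) ^ m.2.card • mul F n (Finsupp.single m 1) (monD F (Sum.inr i) k) := by
  obtain ⟨a, u⟩ := m
  obtain ⟨b, v⟩ := k
  have hD : ∀ (a : Fin n → ℕ) (u : Finset (Fin n)), monD F (Sum.inr i) (a, u) =
      if i ∈ u then Finsupp.single (a, u.erase i) ((-1) ^ below u i) else 0 := fun a u => rfl
  have hpos : ∀ u v : Finset (Fin n), Disjoint u v → monMul F (a, u) (b, v) =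
      Finsupp.single (a + b, u ∪ v)
        ((-1) ^ inversions u v * ∏ i, ((a i + b i).choose (a i) : F)) := fun u v h => by
    simp [monMul, h]
  have hneg : ∀ u v : Finset (Fin n), ¬ Disjoint u v → monMul F (a, u) (b, v) = 0 :=
    fun u v h => by simp [monMul, h]
  simp only [hD]
  by_cases hu : i ∈ u <;> by_cases hv : i ∈ v
  · have hnd : ¬ Disjoint u v := fun h => Finset.disjoint_left.1 h hu hv
    rw [hneg u v hnd, map_zero, if_pos hu, if_pos hv, mul_single, mul_single]
    by_cases h : Disjoint (u.erase i) (v.erase i)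
    · have h1 : Disjoint (u.erase i) v := by
        rw [Finset.disjoint_left] at h ⊢
        intro x hx hx'
        exact h hx (Finset.mem_erase.2 ⟨(Finset.mem_erase.1 hx).1, hx'⟩)
      have h2 : Disjoint u (v.erase i) := by
        rw [Finset.disjoint_right] at h ⊢
        intro x hx hx'
        exact h hx (Finset.mem_erase.2 ⟨(Finset.mem_erase.1 hx).1, hx'⟩)
      have hU : u.erase i ∪ v = u ∪ v := by
        ext x; simp only [Finset.mem_union, Finset.mem_erase]
        by_cases hx : x = i
        · subst hx; simp [hv]
        · simp [hx]
      have hV : u ∪ v.erase i = u ∪ v := by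
        ext x; simp only [Finset.mem_union, Finset.mem_erase]
        by_cases hx : x = i
        · subst hx; simp [hu]
        · simp [hx]
      rw [hpos _ _ h1, hpos _ _ h2, hU, hV]
      simp only [Finsupp.smul_single, smul_eq_mul, ← Finsupp.single_add]
      rw [eq_comm, Finsupp.single_eq_zero]
      have hs : (-1 : F) ^ (below u i + inversions (u.erase i) v) =
          (-1) ^ (u.card + below v i + inversions u (v.erase i) + 1) := by
        apply neg_one_pow_eq
        rw [inversions_erase_right (u.erase i) v i hv,
          inversions_erase_left u (v.erase i) i hu, below_erase]
        have := above_add_below (u.erase i) i (Finset.notMem_erase i u)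
        rw [below_erase] at this
        have h3 := Finset.card_erase_add_one hu
        exact ⟨1 + below v i, 0, by omega⟩
      simp only [pow_add, pow_one] at hs
      simp only [mul_one]
      rw [← mul_assoc, hs]
      ring
    · have h1 : ¬ Disjoint (u.erase i) v := fun h' =>
        h (h'.mono_right (Finset.erase_subset _ _))
      have h2 : ¬ Disjoint u (v.erase i) := fun h' =>
        h (h'.mono_left (Finset.erase_subset _ _))
      rw [hneg _ _ h1, hneg _ _ h2]
      simp
  · rw [if_pos hu, if_neg hv, map_zero, smul_zero, add_zero, mul_single]
    by_cases h : Disjoint u v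
    · have h1 : Disjoint (u.erase i) v := h.mono_left (Finset.erase_subset _ _)
      rw [hpos _ _ h, hpos _ _ h1, D_single, hD, if_pos (Finset.mem_union_left _ hu)]
      have hU : (u ∪ v).erase i = u.erase i ∪ v := by
        rw [Finset.erase_union_distrib, Finset.erase_eq_of_notMem hv]
      rw [hU]
      simp only [Finsupp.smul_single, smul_eq_mul]
      congr 1
      have hs : (-1 : F) ^ (inversions u v + below (u ∪ v) i) =
          (-1) ^ (below u i + inversions (u.erase i) v) := by
        apply neg_one_pow_eq
        rw [inversions_erase_left u v i hu, below_union _ _ _ h]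
        exact ⟨0, below v i, by omega⟩
      simp only [pow_add] at hs
      simp only [mul_one]
      rw [← mul_assoc, ← hs]
      ring
    · have h1 : ¬ Disjoint (u.erase i) v := by
        rw [Finset.not_disjoint_iff] at h ⊢
        obtain ⟨x, hx, hx'⟩ := h
        exact ⟨x, Finset.mem_erase.2 ⟨fun e => hv (e ▸ hx'), hx⟩, hx'⟩
      rw [hneg _ _ h, hneg _ _ h1]
      simp
  · rw [if_neg hu, if_pos hv, map_zero, LinearMap.zero_apply, zero_add, mul_single]
    by_cases h : Disjoint u v
    · have h1 : Disjoint u (v.erase i) := h.mono_right (Finset.erase_subset _ _)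
      rw [hpos _ _ h, hpos _ _ h1, D_single, hD, if_pos (Finset.mem_union_right _ hv)]
      have hU : (u ∪ v).erase i = u ∪ v.erase i := by
        rw [Finset.erase_union_distrib, Finset.erase_eq_of_notMem hu]
      rw [hU]
      simp only [Finsupp.smul_single, smul_eq_mul]
      congr 1
      have hs : (-1 : F) ^ (inversions u v + below (u ∪ v) i) =
          (-1) ^ (u.card + below v i + inversions u (v.erase i)) := by
        apply neg_one_pow_eq
        rw [inversions_erase_right u v i hv, below_union _ _ _ h]
        have := above_add_below u i hu
        exact ⟨0, 0, by omega⟩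
      simp only [pow_add] at hs
      simp only [one_mul]
      rw [← mul_assoc, ← mul_assoc, ← hs]
      ring
    · have h1 : ¬ Disjoint u (v.erase i) := by
        rw [Finset.not_disjoint_iff] at h ⊢
        obtain ⟨x, hx, hx'⟩ := h
        exact ⟨x, hx, Finset.mem_erase.2 ⟨fun e => hu (e ▸ hx), hx'⟩⟩
      rw [hneg _ _ h, hneg _ _ h1]
      simp
  · rw [if_neg hu, if_neg hv, map_zero, map_zero, LinearMap.zero_apply, smul_zero, add_zero]
    by_cases h : Disjoint u v
    · rw [hpos _ _ h, D_single, hD, if_neg (by simp [hu, hv]), smul_zero]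
    · rw [hneg _ _ h, map_zero]

theorem leibniz {a : ZMod 2} {f : Lam F n} (hf : f ∈ lamPart F n a) (g : Lam F n) (i : Idx n) :
    D F i (mul F n f g) =
      mul F n (D F i f) g + sgn F (tau i * a) • mul F n f (D F i g) := by
  induction hf using Submodule.span_induction with
  | mem f h =>
    obtain ⟨m, rfl, rfl⟩ := h
    induction g using Finsupp.induction_linear with
    | zero => simp
    | add f g hf hg => simp only [map_add, hf, hg, smul_add]; abel
    | single k c =>
      have hk : (Finsupp.single k c : Lam F n) = c • Finsupp.single k 1 := by simp
      rw [hk]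
      simp only [map_smul]
      rw [smul_comm _ c, ← smul_add]
      congr 1
      rw [mul_single, D_single, D_single]
      simp only [one_mul, one_smul]
      rcases i with i | i
      · simp only [tau, Sum.elim_inl, zero_mul, sgn_zero, one_smul]
        exact leibniz_even i m k
      · simp only [tau, Sum.elim_inr, one_mul, monDeg, sgn_natCast]
        exact leibniz_odd i m k
  | zero => simp
  | add f g _ _ hf hg => simp only [map_add, LinearMap.add_apply, hf, hg, smul_add]; abel
  | smul c f _ hf =>
    simp only [map_smul, LinearMap.smul_apply, hf, smul_add]
    rw [smul_comm]

theorem monD_comm (i j : Idx n) (m : Mon n) :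
    D F i (monD F j m) = sgn F (tau i * tau j) • D F j (monD F i m) := by
  obtain ⟨a, u⟩ := m
  rcases i with i | i <;> rcases j with j | j
  · simp only [tau, Sum.elim_inl, zero_mul, sgn_zero, one_smul]
    by_cases hij : i = j
    · rw [hij]
    have e1 : (a - Pi.single j 1 : Fin n → ℕ) i = a i := by simp [Pi.single_eq_of_ne hij]
    have e2 : (a - Pi.single i 1 : Fin n → ℕ) j = a j := by
      simp [Pi.single_eq_of_ne (Ne.symm hij)]
    have e3 : a - Pi.single j 1 - Pi.single i 1 = a - Pi.single i 1 - Pi.single j 1 := by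
      funext x; simp only [Pi.sub_apply]; omega
    simp only [monD]
    by_cases hi : a i = 0 <;> by_cases hj : a j = 0 <;>
      simp [hi, hj, D_single, monD, e1, e2, e3]
  · simp only [tau, Sum.elim_inl, zero_mul, sgn_zero, one_smul, monD]
    by_cases hi : a i = 0 <;> by_cases hj : j ∈ u <;>
      simp [hi, hj, D_single, monD]
  · simp only [tau, Sum.elim_inl, mul_zero, sgn_zero, one_smul, monD]
    by_cases hi : i ∈ u <;> by_cases hj : a j = 0 <;>
      simp [hi, hj, D_single, monD]
  · have hD : ∀ (i : Fin n) (a : Fin n → ℕ) (u : Finset (Fin n)), monD F (Sum.inr i) (a, u) =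
        if i ∈ u then Finsupp.single (a, u.erase i) ((-1) ^ below u i) else 0 :=
      fun i a u => rfl
    simp only [tau, Sum.elim_inr, mul_one, sgn_one, hD]
    by_cases hij : i = j
    · subst hij
      by_cases hi : i ∈ u
      · simp [hi, D_single, hD]
      · simp [hi]
    have hb : ∀ x y : Fin n, x < y → x ∈ u →
        below (u.erase y) x = below u x ∧ below (u.erase x) y + 1 = below u y := by
      intro x y hxy hx
      constructor
      · simp only [below]
        congr 1
        ext z
        simp only [Finset.mem_filter, Finset.mem_erase]
        constructor
        · rintro ⟨⟨_, h⟩, h'⟩; exact ⟨h, h'⟩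
        · rintro ⟨h, h'⟩; exact ⟨⟨(h'.trans hxy).ne, h⟩, h'⟩
      · simp only [below]
        rw [Finset.filter_erase, Finset.card_erase_add_one]
        exact Finset.mem_filter.2 ⟨hx, hxy⟩
    by_cases hi : i ∈ u <;> by_cases hj : j ∈ u
    · rw [if_pos hi, if_pos hj, D_single, D_single, hD, hD,
        if_pos (Finset.mem_erase.2 ⟨hij, hi⟩), if_pos (Finset.mem_erase.2 ⟨Ne.symm hij, hj⟩),
        Finset.erase_right_comm]
      simp only [Finsupp.smul_single, smul_eq_mul]
      congr 1
      rcases lt_or_gt_of_ne hij with hl | hl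
      · obtain ⟨h1, h2⟩ := hb i j hl hi
        rw [h1, ← h2, pow_succ]; ring
      · obtain ⟨h1, h2⟩ := hb j i hl hj
        rw [h1, ← h2, pow_succ]; ring
    · simp [hi, hj, D_single, hD]
    · simp [hi, hj, D_single, hD]
    · simp [hi, hj]

theorem D_comm (i j : Idx n) (f : Lam F n) :
    D F i (D F j f) = sgn F (tau i * tau j) • D F j (D F i f) := by
  induction f using Finsupp.induction_linear with
  | zero => simp
  | add f g hf hg => simp only [map_add, hf, hg, smul_add]
  | single m c =>
    simp only [D_single, map_smul]
    rw [monD_comm, smul_comm]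

/-! Formulas on homogeneous elements -/

theorem zmod2_add_self (a : ZMod 2) : a + a = 0 := by revert a; decide

theorem sgn_sq (a : ZMod 2) : sgn F a * sgn F a = 1 := by
  rw [← sgn_add, zmod2_add_self, sgn_zero]

theorem act_mem {a b : ZMod 2} {X : Wit F n} {g : Lam F n} (hX : X ∈ witPart F n a)
    (hg : g ∈ lamPart F n b) : act F n X g ∈ lamPart F n (a + b) := by
  rw [act_apply]
  refine Submodule.sum_mem _ fun i _ => ?_
  have h := mul_mem (mem_witPart.1 hX i) (D_mem hg i)
  have e : a + tau i + (b + tau i) = a + b := by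
    rw [add_add_add_comm, zmod2_add_self, add_zero]
  rwa [e] at h

theorem TH_apply {a : ZMod 2} {f : Lam F n} (hf : f ∈ lamPart F n a) (j : Idx n) :
    TH F n f j = sgn F (tau (bar j) * a) • D F (bar j) f := by
  simp only [TH, LinearMap.pi_apply, LinearMap.sum_apply, LinearMap.smul_apply,
    LinearMap.comp_apply, proj_of_mem hf]
  rw [Finset.sum_eq_single a]
  · simp
  · intro b _ hb; simp [hb]
  · simp

theorem tau_bar (j : Idx n) : tau (bar j) = tau j + 1 := by
  rcases j with j | j
  · simp [tau, bar]
  · simp only [tau, bar, Sum.swap_inr, Sum.elim_inl, Sum.elim_inr]; decide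

theorem bar_bar (j : Idx n) : bar (bar j) = j := Sum.swap_swap j

theorem TH_mem {a : ZMod 2} {f : Lam F n} (hf : f ∈ lamPart F n a) :
    TH F n f ∈ witPart F n (a + 1) := by
  rw [mem_witPart]
  intro j
  rw [TH_apply hf]
  have h := D_mem hf (bar j)
  rw [tau_bar, add_comm (tau j), ← add_assoc] at h
  rw [tau_bar]
  exact Submodule.smul_mem _ _ h

theorem dvg_apply {a : ZMod 2} {X : Wit F n} (hX : X ∈ witPart F n a) :
    dvg F n X = ∑ i, sgn F (tau i * (a + tau i)) • D F i (X i) := by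
  simp only [dvg, LinearMap.sum_apply, LinearMap.smul_apply, LinearMap.comp_apply,
    LinearMap.proj_apply]
  refine Finset.sum_congr rfl fun i _ => ?_
  rw [Finset.sum_eq_single (a + tau i)]
  · rw [proj_of_mem (mem_witPart.1 hX i)]; simp
  · intro b _ hb; rw [proj_of_mem (mem_witPart.1 hX i)]; simp [hb]
  · simp

theorem dvg_mem {a : ZMod 2} {X : Wit F n} (hX : X ∈ witPart F n a) :
    dvg F n X ∈ lamPart F n a := by
  rw [dvg_apply hX]
  refine Submodule.sum_mem _ fun i _ => Submodule.smul_mem _ _ ?_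
  have h := D_mem (mem_witPart.1 hX i) i
  rwa [add_assoc, zmod2_add_self, add_zero] at h

theorem sum_witProj (X : Wit F n) : ∑ a : ZMod 2, witProj F n a X = X := by
  funext i
  rw [Finset.sum_apply]
  simp only [witProj_apply]
  rw [← sum_proj (X i)]
  exact Fintype.sum_equiv (Equiv.addRight (tau i)) _ _ fun a => by simp [sum_proj]

theorem witProj_of_mem {a : ZMod 2} {X : Wit F n} (hX : X ∈ witPart F n a) (b : ZMod 2) :
    witProj F n b X = if b = a then X else 0 := by
  funext i
  rw [witProj_apply, proj_of_mem (mem_witPart.1 hX i)]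
  by_cases h : b = a <;> simp [h]

theorem bracket_apply (X Y : Wit F n) :
    bracket F n X Y = ∑ a : ZMod 2, ∑ b : ZMod 2,
      (comp F n (witProj F n a X) (witProj F n b Y) -
        sgn F (a * b) • comp F n (witProj F n b Y) (witProj F n a X)) := rfl

theorem bracket_hom {a b : ZMod 2} {X Y : Wit F n} (hX : X ∈ witPart F n a)
    (hY : Y ∈ witPart F n b) :
    bracket F n X Y = comp F n X Y - sgn F (a * b) • comp F n Y X := by
  rw [bracket_apply, Finset.sum_eq_single a, Finset.sum_eq_single b]
  · simp [witProj_of_mem hX, witProj_of_mem hY]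
  · intro c _ hc; simp [witProj_of_mem hY, hc]
  · simp
  · intro c _ hc; simp [witProj_of_mem hX, hc]
  · simp

theorem comp_mem {a b : ZMod 2} {X Y : Wit F n} (hX : X ∈ witPart F n a)
    (hY : Y ∈ witPart F n b) : comp F n X Y ∈ witPart F n (a + b) := by
  rw [mem_witPart]
  intro i
  rw [comp_apply, add_assoc]
  exact act_mem hX (mem_witPart.1 hY i)

theorem bracket_mem_part {a b : ZMod 2} {X Y : Wit F n} (hX : X ∈ witPart F n a)
    (hY : Y ∈ witPart F n b) : bracket F n X Y ∈ witPart F n (a + b) := by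
  rw [bracket_hom hX hY]
  refine Submodule.sub_mem _ (comp_mem hX hY) (Submodule.smul_mem _ _ ?_)
  rw [add_comm]
  exact comp_mem hY hX

/-! The divergence of a bracket -/

theorem sgn_eq_of {a b : ZMod 2} (h : a = b) : sgn F a = sgn F b := by rw [h]

theorem dvg_comp {a b : ZMod 2} {X Y : Wit F n} (hX : X ∈ witPart F n a)
    (hY : Y ∈ witPart F n b) :
    dvg F n (comp F n X Y) = act F n X (dvg F n Y) +
      ∑ j, ∑ i, sgn F (tau j * (a + b + tau j)) • mul F n (D F j (X i)) (D F i (Y j)) := by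
  rw [dvg_apply (comp_mem hX hY), dvg_apply hY, map_sum, ← Finset.sum_add_distrib]
  refine Finset.sum_congr rfl fun j _ => ?_
  rw [comp_apply, act_apply, map_smul, act_apply, map_sum, Finset.smul_sum, Finset.smul_sum,
    ← Finset.sum_add_distrib]
  refine Finset.sum_congr rfl fun i _ => ?_
  rw [leibniz (mem_witPart.1 hX i), smul_add, add_comm, D_comm j i, map_smul, smul_smul, smul_smul,
    ← sgn_add, ← sgn_add]
  congr 2
  refine sgn_eq_of ?_
  generalize tau i = x; generalize tau j = y
  clear hX hY
  revert a b x y; decide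

theorem dvg_bracket_hom {a b : ZMod 2} {X Y : Wit F n} (hX : X ∈ witPart F n a)
    (hY : Y ∈ witPart F n b) :
    dvg F n (bracket F n X Y) =
      act F n X (dvg F n Y) - sgn F (a * b) • act F n Y (dvg F n X) := by
  have cross : (∑ j, ∑ i, sgn F (tau j * (a + b + tau j)) • mul F n (D F j (X i)) (D F i (Y j))) =
      sgn F (a * b) • ∑ j, ∑ i,
        sgn F (tau j * (b + a + tau j)) • mul F n (D F j (Y i)) (D F i (X j)) := by
    rw [Finset.sum_comm, Finset.smul_sum]
    refine Finset.sum_congr rfl fun i _ => ?_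
    rw [Finset.smul_sum]
    refine Finset.sum_congr rfl fun j _ => ?_
    rw [mul_comm_super (D_mem (mem_witPart.1 hX i) j) (D_mem (mem_witPart.1 hY j) i),
      smul_smul, smul_smul, ← sgn_add, ← sgn_add]
    congr 1
    refine sgn_eq_of ?_
    generalize tau i = x; generalize tau j = y
    clear hX hY
    revert a b x y; decide
  rw [bracket_hom hX hY, map_sub, map_smul, dvg_comp hX hY, dvg_comp hY hX, cross, smul_add]
  abel

theorem dvg_witProj (a : ZMod 2) (X : Wit F n) :
    dvg F n (witProj F n a X) = proj F n a (dvg F n X) := by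
  conv_rhs => rw [← sum_witProj X, map_sum, map_sum]
  rw [Finset.sum_eq_single a]
  · rw [proj_of_mem (dvg_mem (witProj_mem a X)), if_pos rfl]
  · intro b _ hb
    rw [proj_of_mem (dvg_mem (witProj_mem b X)), if_neg (Ne.symm hb)]
  · simp

theorem bracket_sum (X Y : Wit F n) :
    bracket F n X Y = ∑ a : ZMod 2, ∑ b : ZMod 2,
      bracket F n (witProj F n a X) (witProj F n b Y) := by
  rw [bracket_apply]
  refine Finset.sum_congr rfl fun a _ => Finset.sum_congr rfl fun b _ => ?_
  rw [bracket_hom (witProj_mem a X) (witProj_mem b Y)]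

theorem dvg_bracket_eq_zero {X Y : Wit F n} (hX : dvg F n X = 0) (hY : dvg F n Y = 0) :
    dvg F n (bracket F n X Y) = 0 := by
  rw [bracket_sum, map_sum]
  refine Finset.sum_eq_zero fun a _ => ?_
  rw [map_sum]
  refine Finset.sum_eq_zero fun b _ => ?_
  rw [dvg_bracket_hom (witProj_mem a X) (witProj_mem b Y), dvg_witProj, dvg_witProj, hX, hY]
  simp

/-! The bracket of odd Hamiltonian elements -/

theorem bracket_TH_hom {a b : ZMod 2} {f g : Lam F n} (hf : f ∈ lamPart F n a)
    (hg : g ∈ lamPart F n b) :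
    bracket F n (TH F n f) (TH F n g) = TH F n (act F n (TH F n f) g) := by
  rw [bracket_hom (TH_mem hf) (TH_mem hg)]
  funext j
  rw [TH_apply (act_mem (TH_mem hf) hg), Pi.sub_apply, Pi.smul_apply, comp_apply, comp_apply,
    act_apply, act_apply, act_apply, map_sum, Finset.smul_sum, Finset.smul_sum]
  have e2 : (∑ i, sgn F ((a + 1) * (b + 1)) •
      mul F n (TH F n g i) (D F i (TH F n f j))) =
      ∑ i, sgn F ((a + 1) * (b + 1)) •
        mul F n (TH F n g (bar i)) (D F (bar i) (TH F n f j)) :=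
    (Equiv.sum_comp (Equiv.sumComm (Fin n) (Fin n)) (fun i => sgn F ((a + 1) * (b + 1)) •
      mul F n (TH F n g i) (D F i (TH F n f j)))).symm
  rw [e2, ← Finset.sum_sub_distrib]
  refine Finset.sum_congr rfl fun i _ => ?_
  rw [TH_apply hf, TH_apply hg, TH_apply hf, TH_apply hg, bar_bar]
  simp only [map_smul, LinearMap.smul_apply]
  rw [leibniz (D_mem hf (bar i)), smul_add, smul_add]
  have hswap := mul_comm_super (D_mem hg i) (D_mem (D_mem hf (bar j)) (bar i))
  rw [hswap, D_comm (bar j) i g, D_comm (bar j) (bar i) f]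
  simp only [map_smul, LinearMap.smul_apply, smul_smul, ← sgn_add]
  rw [sub_eq_add_neg, add_comm, ← neg_one_smul F, smul_smul, ← sgn_one (F := F), ← sgn_add]
  rw [tau_bar, tau_bar]
  congr 2
  · refine sgn_eq_of ?_
    generalize tau i = x; generalize tau j = y
    clear hf hg hswap e2
    revert a b x y; decide
  · refine sgn_eq_of ?_
    generalize tau i = x; generalize tau j = y
    clear hf hg hswap e2
    revert a b x y; decide

theorem TH_proj (a : ZMod 2) (f : Lam F n) :
    witProj F n (a + 1) (TH F n f) = TH F n (proj F n a f) := by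
  conv_lhs => rw [← sum_proj f, map_sum, map_sum]
  rw [Finset.sum_eq_single a]
  · rw [witProj_of_mem (TH_mem (proj_mem a f)), if_pos rfl]
  · intro b _ hb
    rw [witProj_of_mem (TH_mem (proj_mem b f)), if_neg]
    intro h; exact hb (add_right_cancel h).symm
  · simp

/-- The formula `[T_H(f), T_H(g)] = T_H(T_H(f)(g))`. -/
theorem bracket_TH (f g : Lam F n) :
    bracket F n (TH F n f) (TH F n g) = TH F n (act F n (TH F n f) g) := by
  have h : bracket F n (TH F n (∑ a, proj F n a f)) (TH F n (∑ b, proj F n b g)) =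
      TH F n (act F n (TH F n (∑ a, proj F n a f)) (∑ b, proj F n b g)) := by
    simp only [map_sum, LinearMap.sum_apply]
    rw [Finset.sum_comm]
    rw [Finset.sum_comm]
    refine Finset.sum_congr rfl fun a _ => Finset.sum_congr rfl fun b _ => ?_
    exact bracket_TH_hom (proj_mem _ f) (proj_mem _ g)
  rwa [sum_proj, sum_proj] at h

/-! The truncated algebra -/

section truncated

variable {p : ℕ} {t : Fin n → ℕ}

theorem single_mem_lamT (m : Mon n) (c : F) (h : ∀ i, m.1 i < p ^ t i) :
    Finsupp.single m c ∈ lamT F n p t := by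
  have : Finsupp.single m c = c • (Finsupp.single m 1 : Lam F n) := by simp
  rw [this]
  exact Submodule.smul_mem _ _ (Submodule.subset_span ⟨m, h, rfl⟩)

theorem D_mem_lamT {f : Lam F n} (hf : f ∈ lamT F n p t) (i : Idx n) :
    D F i f ∈ lamT F n p t := by
  induction hf using Submodule.span_induction with
  | mem f h =>
    obtain ⟨m, hm, rfl⟩ := h
    rw [D_single, one_smul]
    rcases i with i | i
    · simp only [monD]
      split_ifs
      · simp
      · exact single_mem_lamT _ _ fun j => lt_of_le_of_lt (Nat.sub_le _ _) (hm j)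
    · simp only [monD]
      split_ifs
      · exact single_mem_lamT _ _ hm
      · simp
  | zero => simp
  | add f g _ _ hf hg => rw [map_add]; exact Submodule.add_mem _ hf hg
  | smul c f _ hf => rw [map_smul]; exact Submodule.smul_mem _ _ hf

theorem proj_mem_lamT {f : Lam F n} (hf : f ∈ lamT F n p t) (a : ZMod 2) :
    proj F n a f ∈ lamT F n p t := by
  induction hf using Submodule.span_induction with
  | mem f h =>
    obtain ⟨m, hm, rfl⟩ := h
    rw [proj_single]
    split_ifs
    · exact single_mem_lamT _ _ hm
    · simp
  | zero => simp
  | add f g _ _ hf hg => rw [map_add]; exact Submodule.add_mem _ hf hg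
  | smul c f _ hf => rw [map_smul]; exact Submodule.smul_mem _ _ hf

/-- If `a, b < p^s ≤ a + b`, then `p` divides `binom(a+b, a)`. -/
theorem dvd_choose_of_carry (hp : p.Prime) {s a b : ℕ} (ha : a < p ^ s) (hb : b < p ^ s)
    (hab : p ^ s ≤ a + b) : p ∣ (a + b).choose a := by
  have hs : s ≠ 0 := by rintro rfl; simp only [pow_zero] at ha hb hab; omega
  have h := Nat.factorization_choose' (n := b) (k := a) (p := p)
    (b := Nat.log p (b + a) + 1) hp (Nat.lt_succ_self _)
  rw [add_comm b a] at h
  have hne : ((a + b).choose a).factorization p ≠ 0 := by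
    rw [h]
    refine (Finset.card_pos.2 ⟨s, ?_⟩).ne'
    rw [Finset.mem_filter, Finset.mem_Ico]
    refine ⟨⟨Nat.one_le_iff_ne_zero.2 hs, ?_⟩, ?_⟩
    · exact Nat.lt_succ_of_le (Nat.le_log_of_pow_le hp.one_lt hab)
    · rw [Nat.mod_eq_of_lt ha, Nat.mod_eq_of_lt hb]; exact hab
  exact Nat.dvd_of_factorization_pos hne

theorem mul_mem_lamT [Fact p.Prime] [CharP F p] {f g : Lam F n} (hf : f ∈ lamT F n p t)
    (hg : g ∈ lamT F n p t) : mul F n f g ∈ lamT F n p t := by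
  induction hf using Submodule.span_induction with
  | mem f h =>
    obtain ⟨m, hm, rfl⟩ := h
    induction hg using Submodule.span_induction with
    | mem g h =>
      obtain ⟨k, hk, rfl⟩ := h
      rw [mul_single]
      refine Submodule.smul_mem _ _ ?_
      simp only [monMul]
      split_ifs
      · by_cases hlt : ∀ i, m.1 i + k.1 i < p ^ t i
        · exact single_mem_lamT _ _ hlt
        · push Not at hlt
          obtain ⟨i, hi⟩ := hlt
          have h0 : (∏ i, ((m.1 i + k.1 i).choose (m.1 i) : F)) = 0 :=
            Finset.prod_eq_zero (Finset.mem_univ i)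
              ((CharP.cast_eq_zero_iff F p _).2
                (dvd_choose_of_carry Fact.out (hm i) (hk i) hi))
          rw [h0, mul_zero, Finsupp.single_zero]
          exact Submodule.zero_mem _
      · simp
    | zero => simp
    | add f g _ _ hf hg => rw [map_add]; exact Submodule.add_mem _ hf hg
    | smul c f _ hf => rw [map_smul]; exact Submodule.smul_mem _ _ hf
  | zero => simp
  | add f g _ _ hf hg =>
    rw [map_add, LinearMap.add_apply]; exact Submodule.add_mem _ hf hg
  | smul c f _ hf =>
    rw [map_smul, LinearMap.smul_apply]; exact Submodule.smul_mem _ _ hf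

theorem mem_witT {X : Wit F n} : X ∈ witT F n p t ↔ ∀ i, X i ∈ lamT F n p t := by
  simp [witT, Submodule.mem_pi]

theorem act_mem_lamT [Fact p.Prime] [CharP F p] {X : Wit F n} {g : Lam F n}
    (hX : X ∈ witT F n p t) (hg : g ∈ lamT F n p t) : act F n X g ∈ lamT F n p t := by
  rw [act_apply]
  exact Submodule.sum_mem _ fun i _ => mul_mem_lamT (mem_witT.1 hX i) (D_mem_lamT hg i)

theorem witProj_mem_witT {X : Wit F n} (hX : X ∈ witT F n p t) (a : ZMod 2) :
    witProj F n a X ∈ witT F n p t :=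
  mem_witT.2 fun i => proj_mem_lamT (mem_witT.1 hX i) _

theorem bracket_mem_witT [Fact p.Prime] [CharP F p] {X Y : Wit F n} (hX : X ∈ witT F n p t)
    (hY : Y ∈ witT F n p t) : bracket F n X Y ∈ witT F n p t := by
  have hc : ∀ {X Y : Wit F n}, X ∈ witT F n p t → Y ∈ witT F n p t →
      comp F n X Y ∈ witT F n p t := fun hX hY =>
    mem_witT.2 fun i => act_mem_lamT hX (mem_witT.1 hY i)
  rw [bracket_apply]
  refine Submodule.sum_mem _ fun a _ => Submodule.sum_mem _ fun b _ => ?_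
  have h1 := witProj_mem_witT hX a
  have h2 := witProj_mem_witT hY b
  exact Submodule.sub_mem _ (hc h1 h2) (Submodule.smul_mem _ _ (hc h2 h1))

theorem TH_mem_witT {f : Lam F n} (hf : f ∈ lamT F n p t) : TH F n f ∈ witT F n p t := by
  rw [mem_witT]
  intro i
  simp only [TH, LinearMap.pi_apply, LinearMap.sum_apply, LinearMap.smul_apply,
    LinearMap.comp_apply]
  exact Submodule.sum_mem _ fun a _ =>
    Submodule.smul_mem _ _ (D_mem_lamT (proj_mem_lamT hf a) _)

theorem SHOPrime_closed [Fact p.Prime] [CharP F p] {X Y : Wit F n} (hX : X ∈ SHOPrime F n p t)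
    (hY : Y ∈ SHOPrime F n p t) : bracket F n X Y ∈ SHOPrime F n p t := by
  obtain ⟨⟨hX1, hX2⟩, f, hf, rfl⟩ := hX
  obtain ⟨⟨hY1, hY2⟩, g, hg, rfl⟩ := hY
  refine ⟨⟨bracket_mem_witT hX1 hY1, ?_⟩, act F n (TH F n f) g, ?_, ?_⟩
  · exact dvg_bracket_eq_zero hX2 hY2
  · exact act_mem_lamT (TH_mem_witT hf) hg
  · exact (bracket_TH f g).symm

theorem brk_le {M : Submodule F (Wit F n)} (h : ∀ X ∈ M, ∀ Y ∈ M, bracket F n X Y ∈ M) :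
    brk M M ≤ M := by
  refine Submodule.span_le.2 ?_
  rintro _ ⟨X, hX, Y, hY, rfl⟩
  exact h X hX Y hY

theorem brk_closed {M : Submodule F (Wit F n)} (h : ∀ X ∈ M, ∀ Y ∈ M, bracket F n X Y ∈ M) :
    ∀ X ∈ brk M M, ∀ Y ∈ brk M M, bracket F n X Y ∈ brk M M := fun X hX Y hY =>
  Submodule.subset_span ⟨X, brk_le h hX, Y, brk_le h hY, rfl⟩

/-- `SHO(n,n;t)` is a subalgebra of `W(n,n)`. -/
theorem SHO_closed [Fact p.Prime] [CharP F p] {X Y : Wit F n} (hX : X ∈ SHO F n p t)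
    (hY : Y ∈ SHO F n p t) : bracket F n X Y ∈ SHO F n p t :=
  brk_closed (brk_closed fun _ hX _ hY => SHOPrime_closed hX hY) X hX Y hY

end truncated

end closure

/-! ## The Lie superalgebra `SHO(n,n;t)` and its super-biderivations -/

/-- The bracket of `SHO(n,n;t)`, restricted from `W(n,n)`. -/
def shoBracket (F : Type*) [Field F] (n p : ℕ) [Fact p.Prime] [CharP F p] (t : Fin n → ℕ) :
    SHO F n p t →ₗ[F] SHO F n p t →ₗ[F] SHO F n p t :=
  LinearMap.mk₂ F (fun X Y => ⟨bracket F n X.1 Y.1, SHO_closed X.2 Y.2⟩)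
    (fun X X' Y => by ext1; simp)
    (fun c X Y => by ext1; simp)
    (fun X Y Y' => by ext1; simp)
    (fun c X Y => by ext1; simp)

/-- The component of `SHO(n,n;t)` of `ℤ/2`-degree `a`. -/
def shoPart (F : Type*) [Field F] (n p : ℕ) (t : Fin n → ℕ) (a : ZMod 2) :
    Submodule F (SHO F n p t) :=
  (witPart F n a).comap (SHO F n p t).subtype

section biderivation

variable {F L : Type*} [Field F] [AddCommGroup L] [Module F L]

/-- A bilinear map on the superspace `L = L₀ ⊕ L₁` is `ℤ/2`-homogeneous of degree `γ` if
`φ(L_a, L_b) ⊆ L_{a+b+γ}`. -/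
def IsHomogeneousOfDegree (part : ZMod 2 → Submodule F L) (γ : ZMod 2)
    (φ : L →ₗ[F] L →ₗ[F] L) : Prop :=
  ∀ a b : ZMod 2, ∀ x ∈ part a, ∀ y ∈ part b, φ x y ∈ part (a + b + γ)

/-- The space `BDer_γ(L)` of the skew-symmetric super-biderivations of `ℤ/2`-degree `γ` of the
superalgebra `L = L₀ ⊕ L₁` with bracket `br`: the homogeneous bilinear maps `φ` of degree `γ` with
`φ(x,[y,z]) = [φ(x,y),z] + (-1)^{(γ+d(x))d(y)} [y,φ(x,z)]` and
`φ(x,y) = -(-1)^{γ d(x) + γ d(y) + d(x) d(y)} φ(y,x)` for homogeneous `x`, `y` and all `z`. -/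
def BDerOfDegree (part : ZMod 2 → Submodule F L) (br : L →ₗ[F] L →ₗ[F] L) (γ : ZMod 2) :
    Submodule F (L →ₗ[F] L →ₗ[F] L) where
  carrier := {φ | IsHomogeneousOfDegree part γ φ ∧
    (∀ a b : ZMod 2, ∀ x ∈ part a, ∀ y ∈ part b, ∀ z : L,
      φ x (br y z) = br (φ x y) z + sgn F ((γ + a) * b) • br y (φ x z)) ∧
    (∀ a b : ZMod 2, ∀ x ∈ part a, ∀ y ∈ part b,
      φ x y = -(sgn F (γ * a + γ * b + a * b) • φ y x))}
  add_mem' := by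
    rintro φ ψ ⟨h1, h2, h3⟩ ⟨k1, k2, k3⟩
    refine ⟨fun a b x hx y hy => ?_, fun a b x hx y hy z => ?_, fun a b x hx y hy => ?_⟩
    · exact Submodule.add_mem _ (h1 a b x hx y hy) (k1 a b x hx y hy)
    · simp only [LinearMap.add_apply, h2 a b x hx y hy z, k2 a b x hx y hy z, map_add, smul_add]
      abel
    · rw [LinearMap.add_apply, LinearMap.add_apply, h3 a b x hx y hy, k3 a b x hx y hy]
      simp only [LinearMap.add_apply, smul_add, neg_add]
  zero_mem' := by
    refine ⟨fun a b x _ y _ => ?_, fun a b x _ y _ z => ?_, fun a b x _ y _ => ?_⟩ <;> simp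
  smul_mem' := by
    rintro c φ ⟨h1, h2, h3⟩
    refine ⟨fun a b x hx y hy => ?_, fun a b x hx y hy z => ?_, fun a b x hx y hy => ?_⟩
    · exact Submodule.smul_mem _ _ (h1 a b x hx y hy)
    · simp only [LinearMap.smul_apply, h2 a b x hx y hy z, map_smul, smul_add]
      rw [smul_comm c]
    · rw [LinearMap.smul_apply, LinearMap.smul_apply, h3 a b x hx y hy, smul_neg, smul_comm c,
        LinearMap.smul_apply, LinearMap.smul_apply]

/-- The space `BDer(L) = BDer₀(L) ⊕ BDer₁(L)` of all skew-symmetric super-biderivations. -/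
def BDer (part : ZMod 2 → Submodule F L) (br : L →ₗ[F] L →ₗ[F] L) :
    Submodule F (L →ₗ[F] L →ₗ[F] L) :=
  BDerOfDegree part br 0 ⊔ BDerOfDegree part br 1

end biderivation

end OddHam

end

/-! # Odd skew-symmetric super-biderivations of `SHO(n,n;t)` vanish

Only odd super-biderivations `φ` are at issue, and the point is that they are zero on homogeneous
elements. For an odd `φ` on any Lie superalgebra in characteristic other than two,
`[φ(x,y),[u,v]] = ±[[x,y],φ(u,v)]` (`biderivation_bracket`). This is used in two ways. If
`[x,y] = 0`, then `φ(x,y)` centralizes all brackets, hence is zero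
(`biderivation_eq_zero_of_commute`). If `φ(u,v) = 0`, then all values of `φ` commute with `[u,v]`
(`commute_of_biderivation_eq_zero`). So it suffices to produce enough pairs `(u,v)` with
`φ(u,v) = 0`.

All such pairs are found among the fields `T_H(x_c) = ±D_{c'}` and `T_H(x_a x_b)` with `a`, `b` over
distinct elements of `{1,…,n}`. Since `n ≥ 3`, each of them is, up to sign, a bracket of two others,
so they lie in `SHO(n,n;t)` (`fields_mem_SHO`). A field commuting with all `T_H(x_c)` is a linear
combination of them (`exists_eq_sum_linField`), and commuting with `T_H(x_a x_b)` kills the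
coefficients at `a'` and `b'` (`coeff_eq_zero_of_bracket_quadField`).

For `a`, `b` of equal parity, `φ(T_H(x_a x_b), T_H(x_{a'}))` is a constant field commuting with all
quadratic fields of the same parity, hence zero; as the bracket of the arguments is `±T_H(x_b)`, all
values of `φ` are constant fields (`commute_lin`). This is done for odd indices first, where the
only derivative that the bracket relations leave undetermined is an odd one
(`bracket_linField_eq_zero_of_ne`). Next `φ(T_H(x_a x_b), T_H(x_{b'} x_c))` vanishes for even `a`,
`b`, `c`, so all values of `φ` commute with `T_H(x_a x_c)` and involve only `T_H(x_k)` with `k` even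
(`commute_quadratic_even`). These fields are odd, so `φ` vanishes where its value is even
(`biderivation_eq_zero_of_even`), in particular on `(T_H(x_a x_b), T_H(x_{b'} x_c))` for odd `a`,
`b`, `c`; this removes the remaining coefficients.
-/

noncomputable section

namespace OddHam

/-! ### Associativity of `Λ(n,n)` and the super Jacobi identity of `W(n,n)` -/

section algebra

variable {F : Type*} [Field F] {n : ℕ}

theorem inversions_union_left (u v w : Finset (Fin n)) (h : Disjoint u v) :
    inversions (u ∪ v) w = inversions u w + inversions v w :=
  Finset.sum_union h

theorem inversions_union_right (u v w : Finset (Fin n)) (h : Disjoint v w) :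
    inversions u (v ∪ w) = inversions u v + inversions u w := by
  simp only [inversions, ← Finset.sum_add_distrib]
  exact Finset.sum_congr rfl fun a _ => below_union v w a h

theorem choose_mul_choose_assoc (a b c : ℕ) :
    (a + b).choose a * (a + b + c).choose (a + b) =
      (b + c).choose b * (a + (b + c)).choose a := by
  have h := Nat.choose_mul (n := a + b + c) (k := a + b) (s := a) (by omega)
  rw [show a + b + c - a = b + c by omega, show a + b - a = b by omega] at h
  rw [mul_comm, h, mul_comm, add_assoc]

theorem mul_monMul_assoc (m k l : Mon n) :
    mul F n (monMul F m k) (Finsupp.single l 1) =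
      mul F n (Finsupp.single m 1) (monMul F k l) := by
  obtain ⟨a, u⟩ := m
  obtain ⟨b, v⟩ := k
  obtain ⟨c, w⟩ := l
  have hneg : ∀ {a b : Fin n → ℕ} {u v : Finset (Fin n)}, ¬ Disjoint u v →
      monMul F (a, u) (b, v) = 0 := fun h => by simp [monMul, h]
  have hpos : ∀ {a b : Fin n → ℕ} {u v : Finset (Fin n)}, Disjoint u v →
      monMul F (a, u) (b, v) = Finsupp.single (a + b, u ∪ v)
        ((-1) ^ inversions u v * ∏ i, ((a i + b i).choose (a i) : F)) := fun h => by
    simp [monMul, h]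
  by_cases huv : Disjoint u v <;> by_cases hvw : Disjoint v w <;> by_cases huw : Disjoint u w
  · rw [hpos huv, hpos hvw, mul_single, mul_single,
      hpos (Finset.disjoint_union_left.2 ⟨huw, hvw⟩),
      hpos (Finset.disjoint_union_right.2 ⟨huv, huw⟩), Finsupp.smul_single, Finsupp.smul_single,
      inversions_union_left _ _ _ huv, inversions_union_right _ _ _ hvw, Finset.union_assoc,
      add_assoc]
    congr 1
    have hp : (∏ i, ((a i + b i).choose (a i) : F)) *
          ∏ i, (((a + b) i + c i).choose ((a + b) i) : F) =
        (∏ i, ((b i + c i).choose (b i) : F)) * ∏ i, ((a i + (b + c) i).choose (a i) : F) := by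
      rw [← Finset.prod_mul_distrib, ← Finset.prod_mul_distrib]
      refine Finset.prod_congr rfl fun i _ => ?_
      simp only [Pi.add_apply]
      exact_mod_cast congrArg (Nat.cast (R := F)) (choose_mul_choose_assoc (a i) (b i) (c i))
    simp only [smul_eq_mul, mul_one, one_mul, pow_add]
    linear_combination ((-1) ^ inversions u v * (-1) ^ inversions u w * (-1) ^ inversions v w) * hp
  all_goals
    first
    | rw [hneg huv]
    | rw [hpos huv, mul_single,
        hneg (fun h => by simp_all [Finset.disjoint_union_left]), smul_zero]
    first
    | rw [hneg hvw]
    | rw [hpos hvw, mul_single,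
        hneg (fun h => by simp_all [Finset.disjoint_union_right]), smul_zero]
    try simp

theorem mul_assoc_lam (f g h : Lam F n) :
    mul F n (mul F n f g) h = mul F n f (mul F n g h) := by
  induction f using Finsupp.induction_linear with
  | zero => simp
  | add f f' hf hf' => simp only [map_add, LinearMap.add_apply, hf, hf']
  | single m c =>
    induction g using Finsupp.induction_linear with
    | zero => simp
    | add f f' hf hf' => simp only [map_add, LinearMap.add_apply, hf, hf']
    | single k d =>
      induction h using Finsupp.induction_linear with
      | zero => simp
      | add f f' hf hf' => simp only [map_add, hf, hf']
      | single l e =>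
        have hs : ∀ (m : Mon n) (c : F), Finsupp.single m c = c • Finsupp.single m 1 :=
          fun m c => by simp
        have h1 := mul_monMul_assoc (F := F) m k l
        rw [mul_single, mul_single, hs l e, hs m c]
        simp only [map_smul, LinearMap.smul_apply, h1, smul_smul]
        congr 1
        ring

/-- The vector field `[X, Y]` acts on `Λ(n,n)` as the supercommutator of the actions of `X` and
`Y`; the second-order terms cancel. -/
theorem act_bracket {a b : ZMod 2} {X Y : Wit F n} (hX : X ∈ witPart F n a)
    (hY : Y ∈ witPart F n b) (g : Lam F n) :
    act F n (bracket F n X Y) g =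
      act F n X (act F n Y g) - sgn F (a * b) • act F n Y (act F n X g) := by
  have key : ∀ {a b : ZMod 2} {X Y : Wit F n}, X ∈ witPart F n a → Y ∈ witPart F n b →
      act F n X (act F n Y g) = act F n (comp F n X Y) g +
        ∑ j, ∑ i, sgn F (tau i * (b + tau j)) •
          mul F n (mul F n (X i) (Y j)) (D F i (D F j g)) := by
    intro a b X Y hX hY
    rw [act_apply Y, map_sum, act_apply (comp F n X Y), ← Finset.sum_add_distrib]
    refine Finset.sum_congr rfl fun j _ => ?_
    rw [comp_apply, act_apply, act_apply, map_sum, LinearMap.sum_apply, ← Finset.sum_add_distrib]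
    refine Finset.sum_congr rfl fun i _ => ?_
    rw [leibniz (mem_witPart.1 hY j), map_add, map_smul, mul_assoc_lam, mul_assoc_lam]
  have cross : (∑ j, ∑ i, sgn F (tau i * (b + tau j)) •
        mul F n (mul F n (X i) (Y j)) (D F i (D F j g))) =
      sgn F (a * b) • ∑ j, ∑ i, sgn F (tau i * (a + tau j)) •
          mul F n (mul F n (Y i) (X j)) (D F i (D F j g)) := by
    rw [Finset.sum_comm, Finset.smul_sum]
    refine Finset.sum_congr rfl fun i _ => ?_
    rw [Finset.smul_sum]
    refine Finset.sum_congr rfl fun j _ => ?_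
    rw [mul_comm_super (mem_witPart.1 hX i) (mem_witPart.1 hY j), D_comm i j]
    simp only [map_smul, LinearMap.smul_apply, smul_smul, ← sgn_add]
    congr 1
    refine sgn_eq_of ?_
    generalize tau i = x; generalize tau j = y
    clear hX hY key
    revert a b x y; decide
  rw [key hX hY, key hY hX, cross, bracket_hom hX hY, map_sub, map_smul, LinearMap.sub_apply,
    LinearMap.smul_apply, smul_add]
  abel

theorem zmod2_eq_zero_or_one (a : ZMod 2) : a = 0 ∨ a = 1 := by revert a; decide

theorem bracket_skew {a b : ZMod 2} {X Y : Wit F n} (hX : X ∈ witPart F n a)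
    (hY : Y ∈ witPart F n b) :
    bracket F n X Y = -(sgn F (a * b) • bracket F n Y X) := by
  rw [bracket_hom hX hY, bracket_hom hY hX, mul_comm b a, smul_sub, smul_smul, sgn_sq]
  simp

theorem bracket_jacobi {a b c : ZMod 2} {X Y Z : Wit F n} (hX : X ∈ witPart F n a)
    (hY : Y ∈ witPart F n b) (hZ : Z ∈ witPart F n c) :
    bracket F n X (bracket F n Y Z) =
      bracket F n (bracket F n X Y) Z + sgn F (a * b) • bracket F n Y (bracket F n X Z) := by
  rw [bracket_hom hX (bracket_mem_part hY hZ), bracket_hom (bracket_mem_part hX hY) hZ,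
    bracket_hom hY (bracket_mem_part hX hZ)]
  funext j
  simp only [Pi.add_apply, Pi.sub_apply, Pi.smul_apply, comp_apply, act_bracket hX hY,
    act_bracket hX hZ, act_bracket hY hZ]
  simp only [Pi.sub_apply, Pi.smul_apply, comp_apply, bracket_hom hX hY, bracket_hom hX hZ,
    bracket_hom hY hZ, map_sub, map_smul]
  have h2 : (1 + 1 : ZMod 2) = 0 := by decide
  rcases zmod2_eq_zero_or_one a with rfl | rfl <;> rcases zmod2_eq_zero_or_one b with rfl | rfl <;>
    rcases zmod2_eq_zero_or_one c with rfl | rfl <;>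
    simp only [add_zero, zero_add, mul_zero, mul_one, h2, sgn_zero, sgn_one] <;> module

end algebra

/-! ### Odd super-biderivations of a Lie superalgebra -/

section biderivationIdentity

variable {F L : Type*} [Field F] [AddCommGroup L] [Module F L] {part : ZMod 2 → Submodule F L}
  {br : L →ₗ[F] L →ₗ[F] L}

/-- The map `x ↦ φ(x, z)` is a superderivation as well. -/
theorem biderivation_left {γ : ZMod 2} {φ : L →ₗ[F] L →ₗ[F] L} (hφ : φ ∈ BDerOfDegree part br γ)
    (br_mem : ∀ a b : ZMod 2, ∀ x ∈ part a, ∀ y ∈ part b, br x y ∈ part (a + b))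
    {a b c : ZMod 2} {x y z : L} (hx : x ∈ part a) (hy : y ∈ part b) (hz : z ∈ part c) :
    φ (br x y) z = br x (φ y z) + sgn F (b * (γ + c)) • br (φ x z) y := by
  have hder := hφ.2.1
  have hskew := hφ.2.2
  rw [hskew (a + b) c _ (br_mem a b x hx y hy) z hz, hder c a z hz x hx y,
    hskew c a z hz x hx, hskew c b z hz y hy]
  simp only [map_neg, map_smul, LinearMap.neg_apply, LinearMap.smul_apply]
  clear hx hy hz hder hskew hφ br_mem
  have h2 : (1 + 1 : ZMod 2) = 0 := by decide
  rcases zmod2_eq_zero_or_one a with rfl | rfl <;> rcases zmod2_eq_zero_or_one b with rfl | rfl <;>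
    rcases zmod2_eq_zero_or_one c with rfl | rfl <;>
    rcases zmod2_eq_zero_or_one γ with rfl | rfl <;>
    simp only [add_zero, zero_add, mul_zero, mul_one, h2, sgn_zero, sgn_one] <;> module

/-- Comparison of the two expansions of `φ([x,u],[y,v])`, by the derivation property in the first
and then the second variable, and the other way round. -/
theorem biderivation_exchange {φ : L →ₗ[F] L →ₗ[F] L} (hφ : φ ∈ BDerOfDegree part br 1)
    (br_mem : ∀ a b : ZMod 2, ∀ x ∈ part a, ∀ y ∈ part b, br x y ∈ part (a + b))
    (br_skew : ∀ a b : ZMod 2, ∀ x ∈ part a, ∀ y ∈ part b, br x y = -(sgn F (a * b) • br y x))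
    (jacobi : ∀ a b c : ZMod 2, ∀ x ∈ part a, ∀ y ∈ part b, ∀ z ∈ part c,
      br x (br y z) = br (br x y) z + sgn F (a * b) • br y (br x z))
    {a b c d : ZMod 2} {x y u v : L} (hx : x ∈ part a) (hy : y ∈ part b) (hu : u ∈ part c)
    (hv : v ∈ part d) :
    br (φ x y) (br u v) - sgn F (b + c) • br (br x y) (φ u v) =
      sgn F (b * c + b * d + c * d) •
        (br (φ x v) (br u y) - sgn F (d + c) • br (br x v) (φ u y)) := by
  have hhom := hφ.1
  have hleft := @biderivation_left F L _ _ _ part br 1 φ hφ br_mem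
  have e1 : φ (br x u) (br y v) = br x (φ u (br y v)) + _ :=
    hleft hx hu (br_mem b d y hy v hv)
  have e2 := hφ.2.1 (a + c) b _ (br_mem a c x hx u hu) y hy v
  rw [hφ.2.1 c b u hu y hy v, hφ.2.1 a b x hx y hy v] at e1
  rw [hleft hx hu hy, hleft hx hu hv, e1] at e2
  have hxy := hhom a b x hx y hy
  have hxv := hhom a d x hx v hv
  have huy := hhom c b u hu y hy
  have huv := hhom c d u hu v hv
  have j1 := jacobi _ _ _ _ hxy u hu v hv
  have j2 := jacobi _ _ _ y hy _ hxv u hu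
  have j3 := jacobi _ _ _ x hx _ huy v hv
  have j4 := jacobi _ _ _ x hx y hy _ huv
  have s1 := br_skew _ _ _ (br_mem _ _ _ hxy v hv) u hu
  have s4 := br_skew _ _ u hu y hy
  have s5 := br_skew _ _ _ (br_mem _ _ x hx v hv) _ huy
  rw [s4]
  -- The coefficients make both sides agree term by term: `e2` is scaled so that its `φ x y`-terms
  -- add up to `[φ(x,y),[u,v]]` by the Jacobi identity `j1`.
  linear_combination (norm := skip) (-sgn F (c + c * b)) • e2 + j1 + sgn F (c * d) • s1 +
    sgn F (b + c) • j4 + sgn F (c + c * b) • j3 + sgn F (b * c + b * d + c * d + d + c) • s5 -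
    sgn F (c * d + b + a * b) • j2
  simp only [map_add, map_neg, map_smul, LinearMap.add_apply, LinearMap.smul_apply]
  clear e1 e2 j1 j2 j3 j4 s1 s4 s5
  have h2 : (1 + 1 : ZMod 2) = 0 := by decide
  rcases zmod2_eq_zero_or_one a with rfl | rfl <;> rcases zmod2_eq_zero_or_one b with rfl | rfl <;>
    rcases zmod2_eq_zero_or_one c with rfl | rfl <;>
    rcases zmod2_eq_zero_or_one d with rfl | rfl <;>
    simp only [add_zero, zero_add, mul_zero, mul_one, h2, sgn_zero, sgn_one] <;> module

/-- The identity `[φ(x,y),[u,v]] = ±[[x,y],φ(u,v)]`. The defect of this identity is symmetric under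
the exchange of `y` and `v`, and skew-symmetric under that of `x` and `y`. As all transpositions are
conjugate in `S₄`, the exchange of `x` and `v` both preserves and negates it. -/
theorem biderivation_bracket (h2F : (2 : F) ≠ 0) {φ : L →ₗ[F] L →ₗ[F] L}
    (hφ : φ ∈ BDerOfDegree part br 1)
    (br_mem : ∀ a b : ZMod 2, ∀ x ∈ part a, ∀ y ∈ part b, br x y ∈ part (a + b))
    (br_skew : ∀ a b : ZMod 2, ∀ x ∈ part a, ∀ y ∈ part b, br x y = -(sgn F (a * b) • br y x))
    (jacobi : ∀ a b c : ZMod 2, ∀ x ∈ part a, ∀ y ∈ part b, ∀ z ∈ part c,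
      br x (br y z) = br (br x y) z + sgn F (a * b) • br y (br x z))
    {a b c d : ZMod 2} {x y u v : L} (hx : x ∈ part a) (hy : y ∈ part b) (hu : u ∈ part c)
    (hv : v ∈ part d) :
    br (φ x y) (br u v) = sgn F (b + c) • br (br x y) (φ u v) := by
  have E : ∀ {a b c d : ZMod 2} {x y u v : L}, x ∈ part a → y ∈ part b → u ∈ part c →
      v ∈ part d → _ := fun hx hy hu hv =>
    biderivation_exchange hφ br_mem br_skew jacobi hx hy hu hv
  have f1 := E hx hy hu hv
  have f2 := E hv hx hu hy
  have f3 := E hy hx hu hv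
  have hskew := hφ.2.2
  rw [hskew d a v hv x hx, hskew d b v hv y hy, hskew c a u hu x hx, br_skew d a v hv x hx,
    br_skew d b v hv y hy, br_skew c a u hu x hx] at f2
  rw [hskew b a y hy x hx, br_skew b a y hy x hx, hskew c a u hu x hx, br_skew c a u hu x hx] at f3
  rw [← sub_eq_zero, ← smul_right_inj h2F, smul_zero]
  simp only [map_neg, map_smul, LinearMap.neg_apply, LinearMap.smul_apply] at f1 f2 f3
  have h2 : (1 + 1 : ZMod 2) = 0 := by decide
  clear hskew E jacobi br_skew br_mem hφ
  linear_combination (norm := skip)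
    f1 - sgn F (b * c + b * d + c * d + a * d + d + a) • f2 -
    sgn F (a * b + a + b) • f3
  rcases zmod2_eq_zero_or_one a with rfl | rfl <;> rcases zmod2_eq_zero_or_one b with rfl | rfl <;>
    rcases zmod2_eq_zero_or_one c with rfl | rfl <;>
    rcases zmod2_eq_zero_or_one d with rfl | rfl <;>
    simp only [add_zero, zero_add, mul_zero, mul_one, h2, sgn_zero, sgn_one] <;> module

end biderivationIdentity

/-! ### Constant and linear odd Hamiltonian fields -/

section coordinates

variable (F : Type*) [Field F] {n : ℕ}

/-- The unit of `Λ(n,n)`. -/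
def one (F : Type*) [Field F] (n : ℕ) : Lam F n := Finsupp.single (0, ∅) 1

/-- The variable `x_k`, even for `k = inl i` and odd for `k = inr i`. -/
def var : Idx n → Lam F n
  | Sum.inl i => Finsupp.single (Pi.single i 1, ∅) 1
  | Sum.inr i => Finsupp.single (0, {i}) 1

/-- The quadratic potential `x_a x_b`. -/
def quad (a b : Idx n) : Lam F n := mul F n (var F a) (var F b)

/-- The constant vector field `T_H(x_c) = ±D_{c'}`. -/
def linField (c : Idx n) : Wit F n := TH F n (var F c)

/-- The linear vector field `T_H(x_a x_b)`. -/
def quadField (a b : Idx n) : Wit F n := TH F n (quad F a b)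

/-- Indices `a`, `b` with distinct underlying elements of `{1,…,n}`: then `x_a x_b` is a nonzero
potential killed by the Laplacian `∑ D_i D_{i'}`. -/
def Independent (a b : Idx n) : Prop := a ≠ b ∧ b ≠ bar a

variable {F}

theorem mul_one_lam (f : Lam F n) : mul F n f (one F n) = f := by
  induction f using Finsupp.induction_linear with
  | zero => simp
  | add f g hf hg => simp only [map_add, LinearMap.add_apply, hf, hg]
  | single m c => simp [one, mul_single, monMul, inversions]

theorem one_mul_lam (f : Lam F n) : mul F n (one F n) f = f := by
  induction f using Finsupp.induction_linear with
  | zero => simp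
  | add f g hf hg => simp only [map_add, hf, hg]
  | single m c => simp [one, mul_single, monMul, inversions]

theorem one_mem : one F n ∈ lamPart F n 0 := single_mem_part _ _ _ (by simp [monDeg])

theorem var_mem (k : Idx n) : var F k ∈ lamPart F n (tau k) := by
  rcases k with i | i <;> exact single_mem_part _ _ _ (by simp [monDeg, tau])

theorem quad_mem (a b : Idx n) : quad F a b ∈ lamPart F n (tau a + tau b) :=
  mul_mem (var_mem a) (var_mem b)

theorem D_one (i : Idx n) : D F i (one F n) = 0 := by
  rcases i with i | i <;> simp [one, D_single, monD]

theorem D_var (i k : Idx n) : D F i (var F k) = if i = k then one F n else 0 := by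
  rcases i with i | i <;> rcases k with k | k
  · by_cases h : i = k
    · subst h; simp [var, D_single, monD, one]
    · simp [var, D_single, monD, h]
  · simp [var, D_single, monD]
  · simp [var, D_single, monD]
  · by_cases h : i = k
    · subst h; simp [var, D_single, monD, one, Finset.filter_singleton]
    · simp [var, D_single, monD, h]

theorem D_quad (i a b : Idx n) :
    D F i (quad F a b) = (if i = a then var F b else 0) +
      sgn F (tau i * tau a) • (if i = b then var F a else 0) := by
  rw [quad, leibniz (var_mem a), D_var, D_var]
  split_ifs <;> simp [one_mul_lam, mul_one_lam]

theorem D_quad_left {a b : Idx n} (h : a ≠ b) : D F a (quad F a b) = var F b := by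
  simp [D_quad, h]

theorem D_quad_right {a b : Idx n} (h : a ≠ b) :
    D F b (quad F a b) = sgn F (tau b * tau a) • var F a := by
  simp [D_quad, h.symm]

theorem D_quad_of_ne {i a b : Idx n} (ha : i ≠ a) (hb : i ≠ b) : D F i (quad F a b) = 0 := by
  simp [D_quad, ha, hb]

theorem bar_inj {i j : Idx n} : bar i = bar j ↔ i = j :=
  ⟨fun h => by rw [← bar_bar i, h, bar_bar], fun h => h ▸ rfl⟩

theorem bar_eq {i j : Idx n} : bar i = j ↔ i = bar j := by rw [← bar_inj, bar_bar]

theorem Independent.symm {a b : Idx n} (h : Independent a b) : Independent b a :=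
  ⟨h.1.symm, fun e => h.2 (bar_eq.1 e.symm)⟩

theorem Independent.bar_left {a b : Idx n} (h : Independent a b) : Independent (bar a) b :=
  ⟨h.2.symm, by rw [bar_bar]; exact h.1.symm⟩

theorem linField_mem (c : Idx n) : linField F c ∈ witPart F n (tau c + 1) := TH_mem (var_mem c)

theorem quadField_mem (a b : Idx n) : quadField F a b ∈ witPart F n (tau a + tau b + 1) :=
  TH_mem (quad_mem a b)

theorem zmod2_mul_self (a : ZMod 2) : a * a = a := by revert a; decide

theorem linField_apply (c i : Idx n) :
    linField F c i = if i = bar c then sgn F (tau c) • one F n else 0 := by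
  rw [linField, TH_apply (var_mem c), D_var]
  by_cases h : i = bar c
  · subst h; simp [bar_bar, zmod2_mul_self]
  · rw [if_neg h, if_neg (fun e => h (bar_eq.1 e)), smul_zero]

theorem act_linField (c : Idx n) (g : Lam F n) :
    act F n (linField F c) g = sgn F (tau c) • D F (bar c) g := by
  rw [act_apply, Finset.sum_eq_single (bar c)]
  · simp [linField_apply, one_mul_lam]
  · intro i _ hi; simp [linField_apply, hi]
  · simp

theorem comp_linField_right (X : Wit F n) (c : Idx n) : comp F n X (linField F c) = 0 := by
  funext j
  rw [comp_apply, linField_apply, act_apply]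
  split_ifs <;> simp [D_one]

theorem bracket_linField {a : ZMod 2} {X : Wit F n} (hX : X ∈ witPart F n a) (c j : Idx n) :
    bracket F n (linField F c) X j = sgn F (tau c) • D F (bar c) (X j) := by
  rw [bracket_hom (linField_mem c) hX, comp_linField_right, smul_zero, sub_zero, comp_apply,
    act_linField]

theorem bracket_linField_linField (c d : Idx n) :
    bracket F n (linField F c) (linField F d) = 0 := by
  funext j
  rw [bracket_linField (linField_mem d), linField_apply]
  split_ifs <;> simp [D_one]

theorem bracket_linField_quadField (c a b : Idx n) :
    bracket F n (linField F c) (quadField F a b) =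
      sgn F (tau c) • TH F n (D F (bar c) (quad F a b)) := by
  rw [linField, quadField, bracket_TH, ← linField, act_linField, map_smul]

theorem bracket_linField_quadField_left {a b : Idx n} (h : Independent a b) :
    bracket F n (linField F (bar a)) (quadField F a b) = sgn F (tau (bar a)) • linField F b := by
  rw [bracket_linField_quadField, bar_bar, D_quad_left h.1, linField]

theorem bracket_linField_quadField_right {a b : Idx n} (h : Independent a b) :
    bracket F n (linField F (bar b)) (quadField F a b) =
      (sgn F (tau (bar b)) * sgn F (tau b * tau a)) • linField F a := by
  rw [bracket_linField_quadField, bar_bar, D_quad_right h.1, map_smul, linField, smul_smul]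

theorem bracket_linField_quadField_of_ne {c a b : Idx n} (ha : c ≠ bar a) (hb : c ≠ bar b) :
    bracket F n (linField F c) (quadField F a b) = 0 := by
  rw [bracket_linField_quadField,
    D_quad_of_ne (fun e => ha (bar_eq.1 e)) (fun e => hb (bar_eq.1 e)), map_zero, smul_zero]

theorem bracket_quadField_of_ne {a b c d : Idx n} (hca : c ≠ bar a) (hcb : c ≠ bar b)
    (hda : d ≠ bar a) (hdb : d ≠ bar b) :
    bracket F n (quadField F a b) (quadField F c d) = 0 := by
  have h : act F n (quadField F a b) (quad F c d) = 0 := by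
    rw [act_apply]
    refine Finset.sum_eq_zero fun i _ => ?_
    rw [quadField, TH_apply (quad_mem a b)]
    by_cases hi : i = bar a ∨ i = bar b
    · rw [D_quad_of_ne (i := i) (a := c) (b := d), map_zero]
      · rcases hi with rfl | rfl <;> [exact hca.symm; exact hcb.symm]
      · rcases hi with rfl | rfl <;> [exact hda.symm; exact hdb.symm]
    · push Not at hi
      rw [D_quad_of_ne (i := bar i) (fun e => hi.1 (bar_eq.1 e)) (fun e => hi.2 (bar_eq.1 e))]
      simp
  rw [quadField, quadField, bracket_TH, ← quadField, h, map_zero]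

theorem bracket_quadField {a b c : Idx n} (hab : Independent a b) (hbc : Independent b c)
    (hac : Independent a c) :
    bracket F n (quadField F a b) (quadField F (bar b) c) = sgn F (tau b) • quadField F a c := by
  have h : act F n (quadField F a b) (quad F (bar b) c) = sgn F (tau b) • quad F a c := by
    rw [act_apply, Finset.sum_eq_single (bar b)]
    · rw [D_quad_left hbc.bar_left.1, quadField, TH_apply (quad_mem a b), bar_bar,
        D_quad_right hab.1, smul_smul, ← sgn_add, map_smul, LinearMap.smul_apply, quad]
      congr 1
      refine sgn_eq_of ?_
      generalize tau b = x; generalize tau a = y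
      revert x y; decide
    · intro i _ hi
      by_cases hia : i = bar a
      · subst hia
        rw [D_quad_of_ne hi (fun e => hac.2 e.symm), map_zero]
      · rw [quadField, TH_apply (quad_mem a b),
          D_quad_of_ne (i := bar i) (fun e => hia (bar_eq.1 e)) (fun e => hi (bar_eq.1 e))]
        simp
    · simp
  rw [quadField, quadField, bracket_TH, ← quadField, h, map_smul, quadField]

end coordinates

/-! ### Fields commuting with constant fields -/

section centralizer

variable {F : Type*} [Field F] {n : ℕ}

theorem D_inl_apply (i : Fin n) (f : Lam F n) (α : Fin n → ℕ) (u : Finset (Fin n)) :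
    D F (Sum.inl i) f (α, u) = f (α + Pi.single i 1, u) := by
  induction f using Finsupp.induction_linear with
  | zero => simp
  | add f g hf hg => rw [map_add, Finsupp.add_apply, hf, hg, Finsupp.add_apply]
  | single m c =>
    obtain ⟨β, v⟩ := m
    rw [D_single]
    simp only [monD]
    by_cases h : β i = 0
    · rw [if_pos h, smul_zero, Finsupp.single_eq_of_ne]
      · simp
      · intro e
        have := congrFun (congrArg Prod.fst e) i
        simp [h] at this
    · rw [if_neg h, Finsupp.smul_single, smul_eq_mul, mul_one, Finsupp.single_apply,
        Finsupp.single_apply]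
      congr 1
      simp only [Prod.mk.injEq, eq_iff_iff]
      refine and_congr_left fun _ => ⟨fun e => ?_, fun e => ?_⟩
      · rw [← e]
        funext j
        by_cases hj : j = i
        · subst hj; simp; omega
        · simp [Pi.single_eq_of_ne hj]
      · rw [e]; simp

theorem D_inr_apply (i : Fin n) (f : Lam F n) (α : Fin n → ℕ) (u : Finset (Fin n)) (hi : i ∉ u) :
    D F (Sum.inr i) f (α, u) = (-1) ^ below u i * f (α, insert i u) := by
  induction f using Finsupp.induction_linear with
  | zero => simp
  | add f g hf hg => rw [map_add, Finsupp.add_apply, hf, hg, Finsupp.add_apply, mul_add]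
  | single m c =>
    obtain ⟨β, v⟩ := m
    rw [D_single]
    simp only [monD]
    by_cases h : i ∈ v
    · rw [if_pos h, Finsupp.smul_single, smul_eq_mul, Finsupp.single_apply, Finsupp.single_apply]
      by_cases e : β = α ∧ v = insert i u
      · obtain ⟨rfl, rfl⟩ := e
        rw [← below, ← below_erase]
        simp [Finset.erase_insert hi, mul_comm]
      · rw [if_neg, if_neg, mul_zero]
        · simpa using e
        · simp only [Prod.mk.injEq]
          rintro ⟨h1, rfl⟩
          exact e ⟨h1, (Finset.insert_erase h).symm⟩
    · rw [if_neg h, smul_zero, Finsupp.single_eq_of_ne]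
      · simp
      · intro e
        have e2 : insert i u = v := congrArg Prod.snd e
        exact h (e2 ▸ Finset.mem_insert_self i u)

/-- Divided powers have no constants besides the scalars, even in characteristic `p`. -/
theorem eq_smul_one_of_D_eq_zero {f : Lam F n} (h : ∀ i, D F i f = 0) :
    f = f (0, ∅) • one F n := by
  ext ⟨α, u⟩
  by_cases h0 : α = 0 ∧ u = ∅
  · obtain ⟨rfl, rfl⟩ := h0; simp [one]
  rw [one, Finsupp.smul_apply, Finsupp.single_eq_of_ne (by simpa using h0), smul_zero]
  by_cases hα : α = 0
  · obtain ⟨i, hi⟩ := Finset.nonempty_iff_ne_empty.2 fun hu => h0 ⟨hα, hu⟩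
    have := D_inr_apply i f α (u.erase i) (Finset.notMem_erase i u)
    rw [h, Finset.insert_erase hi] at this
    simpa using this.symm
  · obtain ⟨i, hi⟩ := Function.ne_iff.1 hα
    have := D_inl_apply i f (α - Pi.single i 1) u
    rw [h] at this
    rw [← Finsupp.zero_apply (a := (α - Pi.single i 1, u)), this]
    congr 2
    funext j
    by_cases hj : j = i
    · subst hj; simp at hi ⊢; omega
    · simp [Pi.single_eq_of_ne hj]

theorem D_eq_zero_of_bracket {a : ZMod 2} {X : Wit F n} (hX : X ∈ witPart F n a) {c : Idx n}
    (h : bracket F n (linField F c) X = 0) (j : Idx n) : D F (bar c) (X j) = 0 := by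
  have h1 := bracket_linField hX c j
  rw [h, Pi.zero_apply] at h1
  have h2 := congrArg (fun g => sgn F (tau c) • g) h1
  simpa [smul_smul, sgn_sq] using h2.symm

/-- The centralizer of the constant vector fields consists of constant vector fields. -/
theorem exists_eq_sum_linField {a : ZMod 2} {X : Wit F n} (hX : X ∈ witPart F n a)
    (h : ∀ c, bracket F n (linField F c) X = 0) :
    ∃ k : Idx n → F, X = ∑ c, k c • linField F c ∧ ∀ c, tau c + 1 ≠ a → k c = 0 := by
  have hone : ∀ j, X j = X j (0, ∅) • one F n := fun j =>
    eq_smul_one_of_D_eq_zero fun i => by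
      have := D_eq_zero_of_bracket hX (h (bar i)) j
      rwa [bar_bar] at this
  refine ⟨fun c => sgn F (tau c) * X (bar c) (0, ∅), ?_, ?_⟩
  · funext j
    rw [Finset.sum_apply, Finset.sum_eq_single (bar j)]
    · simp only [Pi.smul_apply, linField_apply, bar_bar, if_true, smul_smul]
      rw [mul_right_comm, sgn_sq, one_mul, ← hone]
    · intro c _ hc
      rw [Pi.smul_apply, linField_apply, if_neg, smul_zero]
      exact fun e => hc (bar_eq.1 e.symm)
    · simp
  · intro c hc
    have h0 : a + tau (bar c) ≠ 0 := by
      rw [tau_bar]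
      generalize tau c = x at *
      clear hX
      revert a x; decide
    have h1 := proj_of_mem (mem_witPart.1 hX (bar c)) 0
    rw [if_neg h0.symm, hone, map_smul, proj_of_mem one_mem, if_pos rfl] at h1
    have h2 := DFunLike.congr_fun h1 (0, ∅)
    simp only [Finsupp.smul_apply, one, Finsupp.single_eq_same, smul_eq_mul, mul_one,
      Finsupp.zero_apply] at h2
    simp only [h2, mul_zero]

theorem sgn_ne_zero (x : ZMod 2) : sgn F x ≠ 0 := fun hx => by
  have := sgn_sq (F := F) x
  rw [hx] at this
  simp at this

theorem coeff_eq_zero_of_bracket_quadField {k : Idx n → F} {a b : Idx n} (hab : Independent a b)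
    (h : bracket F n (∑ c, k c • linField F c) (quadField F a b) = 0) :
    k (bar a) = 0 ∧ k (bar b) = 0 := by
  have hne : bar a ≠ bar b := fun e => hab.1 (bar_inj.1 e)
  rw [map_sum, LinearMap.sum_apply, ← Finset.add_sum_erase _ _ (Finset.mem_univ (bar a)),
    ← Finset.add_sum_erase _ _ (Finset.mem_erase.2 ⟨hne.symm, Finset.mem_univ (bar b)⟩),
    Finset.sum_eq_zero, add_zero] at h
  · simp only [map_smul, LinearMap.smul_apply, bracket_linField_quadField_left hab,
      bracket_linField_quadField_right hab] at h
    have h1 := DFunLike.congr_fun (congrFun h (bar b)) (0, ∅)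
    have h2 := DFunLike.congr_fun (congrFun h (bar a)) (0, ∅)
    simp only [Pi.add_apply, Pi.smul_apply, linField_apply, if_true, if_neg hne, if_neg hne.symm,
      smul_zero, add_zero, zero_add, Pi.zero_apply, Finsupp.zero_apply, Finsupp.smul_apply, one,
      smul_eq_mul, Finsupp.single_eq_same, mul_one] at h1 h2
    exact ⟨by simpa [sgn_ne_zero] using h1, by simpa [sgn_ne_zero] using h2⟩
  · intro c hc
    simp only [Finset.mem_erase, Finset.mem_univ, and_true] at hc
    rw [map_smul, LinearMap.smul_apply, bracket_linField_quadField_of_ne hc.2 hc.1, smul_zero]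

/-- An odd Hamiltonian field depending on a single odd variable only is constant: in terms of a
potential `f`, the mixed derivative `D_a D_{j'} f` is a `D_{j'}`-derivative of a component, and
`D_a D_a = 0`. -/
theorem bracket_linField_eq_zero_of_ne (h2F : (2 : F) ≠ 0) {a : ZMod 2} {f : Lam F n}
    (hX : TH F n f ∈ witPart F n a) {c₀ : Idx n} (hc₀ : tau c₀ = 0)
    (h : ∀ c, c ≠ c₀ → bracket F n (linField F c) (TH F n f) = 0) :
    bracket F n (linField F c₀) (TH F n f) = 0 := by
  wlog hf : f ∈ lamPart F n (a + 1) generalizing f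
  · have e := TH_proj (a + 1) f
    rw [add_assoc, zmod2_add_self, add_zero, witProj_of_mem hX, if_pos rfl] at e
    rw [e] at hX h ⊢
    exact this hX h (proj_mem _ f)
  funext j
  rw [bracket_linField hX, TH_apply hf, map_smul, Pi.zero_apply]
  suffices hD : D F (bar c₀) (D F (bar j) f) = 0 by rw [hD, smul_zero, smul_zero]
  have hs := D_comm (bar c₀) (bar j) f
  by_cases hj : bar j = bar c₀
  · rw [hj] at hs ⊢
    rw [tau_bar, hc₀] at hs
    simp only [zero_add, mul_one, sgn_one] at hs
    refine (smul_eq_zero.1 ?_).resolve_left h2F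
    rw [two_smul]
    nth_rewrite 1 [hs]
    simp
  · have h1 := D_eq_zero_of_bracket hX (h j fun e => hj (e ▸ rfl)) c₀
    rw [TH_apply hf, map_smul] at h1
    have h2 := congrArg (fun g => sgn F (tau (bar c₀) * (a + 1)) • g) h1
    simp only [smul_smul, sgn_sq, one_smul, smul_zero] at h2
    rw [hs, h2, smul_zero]

end centralizer

theorem independent_iff {n : ℕ} {a b : Idx n} :
    Independent a b ↔ Sum.elim id id a ≠ Sum.elim id id b := by
  rcases a with i | i <;> rcases b with j | j <;> simp [Independent, bar, eq_comm]

theorem exists_independent {n : ℕ} (hn : 3 ≤ n) (a b : Idx n) (ε : ZMod 2) :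
    ∃ c : Idx n, tau c = ε ∧ Independent a c ∧ Independent c b := by
  obtain ⟨k, hka, hkb⟩ : ∃ k : Fin n, k ≠ Sum.elim id id a ∧ k ≠ Sum.elim id id b := by
    by_contra! h
    have h1 : (Finset.univ : Finset (Fin n)) ⊆ {Sum.elim id id a, Sum.elim id id b} :=
      fun k _ => by
        by_cases hk : k = Sum.elim id id a
        · simp [hk]
        · simp [h k hk]
    have h2 := (Finset.card_le_card h1).trans Finset.card_le_two
    rw [Finset.card_univ, Fintype.card_fin] at h2
    omega
  rcases zmod2_eq_zero_or_one ε with rfl | rfl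
  · exact ⟨Sum.inl k, rfl, independent_iff.2 hka.symm, independent_iff.2 hkb⟩
  · exact ⟨Sum.inr k, rfl, independent_iff.2 hka.symm, independent_iff.2 hkb⟩

/-! ### Membership in `SHO(n,n;t)` -/

section membership

variable {F : Type*} [Field F] {n p : ℕ} {t : Fin n → ℕ}

theorem SHOBar_le [Fact p.Prime] [CharP F p] : SHOBar F n p t ≤ SHOPrime F n p t :=
  brk_le fun _ hX _ hY => SHOPrime_closed hX hY

theorem SHO_le [Fact p.Prime] [CharP F p] : SHO F n p t ≤ SHOPrime F n p t :=
  (brk_le (brk_closed fun _ hX _ hY => SHOPrime_closed hX hY)).trans SHOBar_le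

theorem dvg_TH_eq_zero {a : ZMod 2} {f : Lam F n} (hf : f ∈ lamPart F n a)
    (h : ∀ i, D F i (D F (bar i) f) = 0) : dvg F n (TH F n f) = 0 := by
  rw [dvg_apply (TH_mem hf)]
  refine Finset.sum_eq_zero fun i _ => ?_
  rw [TH_apply hf, map_smul, h, smul_zero, smul_zero]

theorem TH_mem_SHOPrime {a : ZMod 2} {f : Lam F n} (hf : f ∈ lamPart F n a)
    (hft : f ∈ lamT F n p t) (h : ∀ i, D F i (D F (bar i) f) = 0) :
    TH F n f ∈ SHOPrime F n p t :=
  ⟨⟨TH_mem_witT hft, dvg_TH_eq_zero hf h⟩, f, hft, rfl⟩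

/-- Each of the fields `T_H(x_c)` and `T_H(x_a x_b)` is, up to sign, a bracket of two others; the
quadratic ones need a third index, whence `n ≥ 3`. -/
theorem fields_mem_brk (hn : 3 ≤ n) {M : Submodule F (Wit F n)} (hlin : ∀ c, linField F c ∈ M)
    (hquad : ∀ a b, Independent a b → quadField F a b ∈ M) :
    (∀ c, linField F c ∈ brk M M) ∧ ∀ a b, Independent a b → quadField F a b ∈ brk M M := by
  constructor
  · intro c
    obtain ⟨a, -, -, ha⟩ := exists_independent hn c c 0
    refine (Submodule.smul_mem_iff _ (sgn_ne_zero (F := F) (tau (bar a)))).1 ?_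
    rw [← bracket_linField_quadField_left ha]
    exact Submodule.subset_span ⟨_, hlin _, _, hquad _ _ ha, rfl⟩
  · intro a b hab
    obtain ⟨c, -, hac, hcb⟩ := exists_independent hn a b 0
    refine (Submodule.smul_mem_iff _ (sgn_ne_zero (F := F) (tau c))).1 ?_
    rw [← bracket_quadField hac hcb hab]
    exact Submodule.subset_span ⟨_, hquad _ _ hac, _, hquad _ _ hcb.bar_left, rfl⟩

variable [Fact p.Prime]

theorem var_mem_lamT (ht : ∀ i, 0 < t i) (k : Idx n) : var F k ∈ lamT F n p t := by
  have hp : p.Prime := Fact.out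
  rcases k with i | i
  · refine single_mem_lamT _ _ fun j => ?_
    refine lt_of_le_of_lt ?_ (Nat.one_lt_pow (ht j).ne' hp.one_lt)
    by_cases hj : j = i
    · subst hj; simp
    · simp [Pi.single_eq_of_ne hj]
  · exact single_mem_lamT _ _ fun j => pow_pos hp.pos _

theorem linField_mem_SHOPrime (ht : ∀ i, 0 < t i) (c : Idx n) :
    linField F c ∈ SHOPrime F n p t := by
  refine TH_mem_SHOPrime (var_mem c) (var_mem_lamT ht c) fun i => ?_
  rw [D_var]
  split_ifs <;> simp [D_one]

variable [CharP F p]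

theorem quadField_mem_SHOPrime (ht : ∀ i, 0 < t i) {a b : Idx n} (h : Independent a b) :
    quadField F a b ∈ SHOPrime F n p t := by
  refine TH_mem_SHOPrime (quad_mem a b) (mul_mem_lamT (var_mem_lamT ht a) (var_mem_lamT ht b))
    fun i => ?_
  have h1 : bar i = a → i ≠ b := fun e e' => h.2 (by rw [← e, ← e', bar_bar])
  have h2 : bar i = b → i ≠ a := fun e e' => h.2 (by rw [← e, ← e'])
  rw [D_quad, map_add, map_smul]
  split_ifs with ha hb hb
  · exact absurd (ha.symm.trans hb) h.1
  · simp [D_var, h1 ha]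
  · simp [D_var, h2 hb]
  · simp

theorem fields_mem_SHO (hn : 3 ≤ n) (ht : ∀ i, 0 < t i) :
    (∀ c, linField F c ∈ SHO F n p t) ∧
      ∀ a b, Independent a b → quadField F a b ∈ SHO F n p t := by
  have h := fields_mem_brk (F := F) hn (linField_mem_SHOPrime (p := p) ht)
    fun _ _ => quadField_mem_SHOPrime (p := p) ht
  exact fields_mem_brk hn h.1 h.2

end membership

/-! ### Vanishing of odd super-biderivations of `SHO(n,n;t)` -/

section vanishing

variable {F : Type*} [Field F] {n p : ℕ} [Fact p.Prime] [CharP F p] {t : Fin n → ℕ}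

theorem shoBracket_mem (a b : ZMod 2) (x : SHO F n p t) (hx : x ∈ shoPart F n p t a)
    (y : SHO F n p t) (hy : y ∈ shoPart F n p t b) :
    shoBracket F n p t x y ∈ shoPart F n p t (a + b) :=
  bracket_mem_part (X := x.1) (Y := y.1) hx hy

theorem shoBracket_skew (a b : ZMod 2) (x : SHO F n p t) (hx : x ∈ shoPart F n p t a)
    (y : SHO F n p t) (hy : y ∈ shoPart F n p t b) :
    shoBracket F n p t x y = -(sgn F (a * b) • shoBracket F n p t y x) :=
  Subtype.ext (bracket_skew (X := x.1) (Y := y.1) hx hy)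

theorem shoBracket_jacobi (a b c : ZMod 2) (x : SHO F n p t) (hx : x ∈ shoPart F n p t a)
    (y : SHO F n p t) (hy : y ∈ shoPart F n p t b) (z : SHO F n p t)
    (hz : z ∈ shoPart F n p t c) :
    shoBracket F n p t x (shoBracket F n p t y z) =
      shoBracket F n p t (shoBracket F n p t x y) z +
        sgn F (a * b) • shoBracket F n p t y (shoBracket F n p t x z) :=
  Subtype.ext (bracket_jacobi (X := x.1) (Y := y.1) (Z := z.1) hx hy hz)

theorem shoBracket_swap {a b : ZMod 2} {x y : SHO F n p t} (hx : x ∈ shoPart F n p t a)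
    (hy : y ∈ shoPart F n p t b) :
    shoBracket F n p t x y = (-sgn F (a * b)) • shoBracket F n p t y x :=
  Subtype.ext ((bracket_skew (X := x.1) (Y := y.1) hx hy).trans (neg_smul _ _).symm)

theorem shoBracket_eq_zero_comm {a b : ZMod 2} {x y : SHO F n p t}
    (hx : x ∈ shoPart F n p t a) (hy : y ∈ shoPart F n p t b)
    (h : shoBracket F n p t x y = 0) : shoBracket F n p t y x = 0 := by
  rw [shoBracket_swap hy hx, h, smul_zero]

variable (hn : 3 ≤ n) (ht : ∀ i, 0 < t i)

/-- `T_H(x_c)` as an element of `SHO(n,n;t)`. -/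
def lin (c : Idx n) : SHO F n p t := ⟨linField F c, (fields_mem_SHO hn ht).1 c⟩

/-- `T_H(x_a x_b)` as an element of `SHO(n,n;t)`. -/
def quadratic {a b : Idx n} (h : Independent a b) : SHO F n p t :=
  ⟨quadField F a b, (fields_mem_SHO hn ht).2 a b h⟩

theorem lin_mem (c : Idx n) : lin (F := F) (p := p) hn ht c ∈ shoPart F n p t (tau c + 1) :=
  linField_mem (F := F) c

theorem quadratic_mem {a b : Idx n} (h : Independent a b) :
    quadratic (F := F) (p := p) hn ht h ∈ shoPart F n p t (tau a + tau b + 1) :=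
  quadField_mem (F := F) a b

theorem shoBracket_lin_quadratic {a b : Idx n} (h : Independent a b) :
    shoBracket F n p t (lin hn ht (bar a)) (quadratic hn ht h) =
      sgn F (tau (bar a)) • lin hn ht b :=
  Subtype.ext (bracket_linField_quadField_left h)

theorem shoBracket_lin_quadratic_right {a b : Idx n} (h : Independent a b) :
    shoBracket F n p t (lin hn ht (bar b)) (quadratic hn ht h) =
      (sgn F (tau (bar b)) * sgn F (tau b * tau a)) • lin hn ht a :=
  Subtype.ext (bracket_linField_quadField_right h)

theorem shoBracket_lin_quadratic_of_ne {a b c : Idx n} (h : Independent a b) (ha : c ≠ bar a)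
    (hb : c ≠ bar b) : shoBracket F n p t (lin hn ht c) (quadratic hn ht h) = 0 :=
  Subtype.ext (bracket_linField_quadField_of_ne ha hb)

theorem shoBracket_lin_lin (c d : Idx n) :
    shoBracket F n p t (lin hn ht c) (lin hn ht d) = 0 :=
  Subtype.ext (bracket_linField_linField c d)

theorem shoBracket_quadratic {a b c : Idx n} (hab : Independent a b) (hbc : Independent b c)
    (hac : Independent a c) :
    shoBracket F n p t (quadratic hn ht hab) (quadratic hn ht hbc.bar_left) =
      sgn F (tau b) • quadratic hn ht hac :=
  Subtype.ext (bracket_quadField hab hbc hac)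

theorem shoBracket_quadratic_of_ne {a b c d : Idx n} (hab : Independent a b)
    (hcd : Independent c d) (hca : c ≠ bar a) (hcb : c ≠ bar b) (hda : d ≠ bar a)
    (hdb : d ≠ bar b) :
    shoBracket F n p t (quadratic hn ht hab) (quadratic hn ht hcd) = 0 :=
  Subtype.ext (bracket_quadField_of_ne hca hcb hda hdb)

/-- An element of parity `a` commuting with all `T_H(x_c)` is zero if for each `c` with `T_H(x_c)`
of parity `a` it commutes with some quadratic field involving `x_{c'}`. -/
theorem eq_zero_of_commute {a : ZMod 2} {x : SHO F n p t} (hx : x ∈ shoPart F n p t a)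
    (hlin : ∀ c, shoBracket F n p t x (lin hn ht c) = 0)
    (hquad : ∀ c, tau c + 1 = a → ∃ (u v : Idx n) (h : Independent u v),
      (bar c = u ∨ bar c = v) ∧ shoBracket F n p t x (quadratic hn ht h) = 0) : x = 0 := by
  obtain ⟨k, hk, hk0⟩ := exists_eq_sum_linField (X := x.1) hx fun c =>
    congrArg Subtype.val (shoBracket_eq_zero_comm hx (lin_mem hn ht c) (hlin c))
  refine Subtype.ext (hk.trans (Finset.sum_eq_zero fun c _ => ?_))
  suffices k c = 0 by rw [this, zero_smul]
  by_cases hc : tau c + 1 = a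
  · obtain ⟨u, v, h, huv, h0⟩ := hquad c hc
    have h1 : bracket F n x.1 (quadField F u v) = 0 := congrArg Subtype.val h0
    rw [hk] at h1
    obtain ⟨h2, h3⟩ := coeff_eq_zero_of_bracket_quadField h h1
    rcases huv with rfl | rfl
    · rwa [bar_bar] at h2
    · rwa [bar_bar] at h3
  · exact hk0 c hc

theorem tau_bar_ne {a b : Idx n} (h : tau a = tau b) : a ≠ bar b := by
  rintro rfl
  rw [tau_bar] at h
  revert h; generalize tau b = x; revert x; decide

variable (h2F : (2 : F) ≠ 0)
  {φ : SHO F n p t →ₗ[F] SHO F n p t →ₗ[F] SHO F n p t}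
  (hφ : φ ∈ BDerOfDegree (L := SHO F n p t) (shoPart F n p t) (shoBracket F n p t) 1)
include hφ

theorem biderivation_swap {a b : ZMod 2} {x y : SHO F n p t} (hx : x ∈ shoPart F n p t a)
    (hy : y ∈ shoPart F n p t b) : φ x y = (-sgn F (1 * a + 1 * b + a * b)) • φ y x :=
  (hφ.2.2 a b x hx y hy).trans (neg_smul _ _).symm

include h2F

theorem shoBracket_biderivation {a b c d : ZMod 2} {x y u v : SHO F n p t}
    (hx : x ∈ shoPart F n p t a) (hy : y ∈ shoPart F n p t b) (hu : u ∈ shoPart F n p t c)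
    (hv : v ∈ shoPart F n p t d) :
    shoBracket F n p t (φ x y) (shoBracket F n p t u v) =
      sgn F (b + c) • shoBracket F n p t (shoBracket F n p t x y) (φ u v) :=
  biderivation_bracket h2F hφ shoBracket_mem shoBracket_skew shoBracket_jacobi hx hy hu hv

/-- If `φ(u,v) = 0`, then all values of `φ` commute with `[u,v]`. -/
theorem commute_of_biderivation_eq_zero {a b c d : ZMod 2} {x y u v z : SHO F n p t}
    (hx : x ∈ shoPart F n p t a) (hy : y ∈ shoPart F n p t b) (hu : u ∈ shoPart F n p t c)
    (hv : v ∈ shoPart F n p t d) (huv : φ u v = 0) {s : F} (hs : s ≠ 0)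
    (hz : shoBracket F n p t u v = s • z) : shoBracket F n p t (φ x y) z = 0 := by
  have h := shoBracket_biderivation h2F hφ hx hy hu hv
  rw [huv, map_zero, smul_zero, hz, map_smul] at h
  exact (smul_eq_zero.1 h).resolve_left hs

include hn ht

theorem biderivation_eq_zero_of_commute {a b : ZMod 2} {x y : SHO F n p t}
    (hx : x ∈ shoPart F n p t a) (hy : y ∈ shoPart F n p t b)
    (hxy : shoBracket F n p t x y = 0) : φ x y = 0 := by
  have key : ∀ {c d : ZMod 2} {u v z : SHO F n p t}, u ∈ shoPart F n p t c →
      v ∈ shoPart F n p t d → ∀ {s : F}, s ≠ 0 → shoBracket F n p t u v = s • z →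
      shoBracket F n p t (φ x y) z = 0 := by
    intro c d u v z hu hv s hs hz
    have h := shoBracket_biderivation h2F hφ hx hy hu hv
    rw [hxy, map_zero, LinearMap.zero_apply, smul_zero, hz, map_smul] at h
    exact (smul_eq_zero.1 h).resolve_left hs
  refine eq_zero_of_commute hn ht (hφ.1 a b x hx y hy) (fun c => ?_) fun c _ => ?_
  · obtain ⟨e, -, -, he⟩ := exists_independent hn c c 0
    exact key (lin_mem hn ht (bar e)) (quadratic_mem hn ht he) (sgn_ne_zero _)
      (shoBracket_lin_quadratic hn ht he)
  · obtain ⟨d, -, hd, -⟩ := exists_independent hn (bar c) (bar c) 0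
    obtain ⟨e, -, hce, hed⟩ := exists_independent hn (bar c) d 0
    exact ⟨bar c, d, hd, Or.inl rfl, key (quadratic_mem hn ht hce)
      (quadratic_mem hn ht hed.bar_left) (sgn_ne_zero _) (shoBracket_quadratic hn ht hce hed hd)⟩

/-- If `u` commutes with `z` and with `[y,z]`, then `φ(u,y)` commutes with `z`. -/
theorem commute_biderivation {a b c : ZMod 2} {u y z : SHO F n p t}
    (hu : u ∈ shoPart F n p t a) (hy : y ∈ shoPart F n p t b) (hz : z ∈ shoPart F n p t c)
    (huz : shoBracket F n p t u z = 0)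
    (huyz : shoBracket F n p t u (shoBracket F n p t y z) = 0) :
    shoBracket F n p t (φ u y) z = 0 := by
  have h := hφ.2.1 a b u hu y hy z
  rw [biderivation_eq_zero_of_commute hn ht h2F hφ hu hz huz,
    biderivation_eq_zero_of_commute hn ht h2F hφ hu (shoBracket_mem _ _ _ hy _ hz) huyz] at h
  simpa using h.symm

/-- `φ(T_H(x_a x_b), T_H(x_{a'}))` vanishes for `a`, `b` of equal parity as soon as it is a constant
vector field. -/
theorem biderivation_quadratic_lin_of_commute {a b : Idx n} (hab : Independent a b)
    (hτ : tau a = tau b)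
    (h : ∀ c, shoBracket F n p t (φ (quadratic hn ht hab) (lin hn ht (bar a))) (lin hn ht c) = 0) :
    φ (quadratic hn ht hab) (lin hn ht (bar a)) = 0 := by
  have hu := quadratic_mem (F := F) (p := p) hn ht hab
  have hy := lin_mem (F := F) (p := p) hn ht (bar a)
  refine eq_zero_of_commute hn ht (hφ.1 _ _ _ hu _ hy) h fun c hc => ?_
  have hc' : tau (bar c) = tau a := by
    rw [← hτ, tau_bar] at hc
    rw [tau_bar, hc]
    generalize tau a = x
    revert x; decide
  obtain ⟨d, hd, hcd, -⟩ := exists_independent hn (bar c) (bar c) (tau a)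
  refine ⟨bar c, d, hcd, Or.inl rfl,
    commute_biderivation hn ht h2F hφ hu hy (quadratic_mem hn ht hcd)
      (shoBracket_quadratic_of_ne hn ht hab hcd (tau_bar_ne hc') (tau_bar_ne (hc'.trans hτ))
        (tau_bar_ne hd) (tau_bar_ne (hd.trans hτ))) ?_⟩
  have hlin : ∀ e, tau e = tau a →
      shoBracket F n p t (quadratic hn ht hab) (lin hn ht e) = 0 := fun e he =>
    shoBracket_eq_zero_comm (lin_mem hn ht e) hu
      (shoBracket_lin_quadratic_of_ne hn ht hab (tau_bar_ne he) (tau_bar_ne (he.trans hτ)))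
  by_cases h1 : a = bar c
  · subst h1
    rw [shoBracket_lin_quadratic, map_smul, hlin d hd, smul_zero]
  by_cases h2 : a = d
  · subst h2
    rw [shoBracket_lin_quadratic_right, map_smul, hlin _ hc', smul_zero]
  · rw [shoBracket_lin_quadratic_of_ne hn ht hcd (fun e => h1 (bar_inj.1 e))
      (fun e => h2 (bar_inj.1 e)), map_zero]

theorem commute_lin_of_ne {a b : Idx n} (hab : Independent a b) {c : Idx n} (ha : c ≠ bar a)
    (hb : c ≠ bar b) :
    shoBracket F n p t (φ (quadratic hn ht hab) (lin hn ht (bar a))) (lin hn ht c) = 0 := by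
  refine commute_biderivation hn ht h2F hφ (quadratic_mem hn ht hab) (lin_mem hn ht _)
    (lin_mem hn ht c) (shoBracket_eq_zero_comm (lin_mem hn ht c) (quadratic_mem hn ht hab)
      (shoBracket_lin_quadratic_of_ne hn ht hab ha hb)) ?_
  rw [shoBracket_lin_lin, map_zero]

/-- All values of `φ` commute with `T_H(x_e)` for odd `e`, i.e. with the even derivations
`D_{e'}`. -/
theorem commute_lin_odd {a b : ZMod 2} {x y : SHO F n p t} (hx : x ∈ shoPart F n p t a)
    (hy : y ∈ shoPart F n p t b) {e : Idx n} (he : tau e = 1) :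
    shoBracket F n p t (φ x y) (lin hn ht e) = 0 := by
  obtain ⟨c, hc, -, hce⟩ := exists_independent hn e e 1
  have hu := quadratic_mem (F := F) (p := p) hn ht hce
  have hv := lin_mem (F := F) (p := p) hn ht (bar c)
  have hv1 : lin (F := F) (p := p) hn ht (bar c) ∈ shoPart F n p t 1 := by
    have h := hv
    rwa [tau_bar, hc] at h
  have hu1 : quadratic (F := F) (p := p) hn ht hce ∈ shoPart F n p t 1 := by
    have h := hu
    rwa [hc, he] at h
  have hA1 := hφ.1 1 1 _ hu1 _ hv1
  refine commute_of_biderivation_eq_zero h2F hφ hx hy hv hu ?_ (sgn_ne_zero _)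
    (shoBracket_lin_quadratic hn ht hce)
  suffices h : φ (quadratic hn ht hce) (lin hn ht (bar c)) = 0 by
    rw [biderivation_swap hφ hv hu, h, smul_zero]
  refine biderivation_quadratic_lin_of_commute hn ht h2F hφ hce (hc.trans he.symm) ?_
  have hne : ∀ d, d ≠ bar e →
      shoBracket F n p t (φ (quadratic hn ht hce) (lin hn ht (bar c))) (lin hn ht d) = 0 := by
    intro d hd
    by_cases hdc : d = bar c
    · subst hdc
      -- The value of `φ` and `T_H(x_{c'}) = ±D_c` are both odd, so the derivation property on
      -- `[D_c, D_c] = 0` reads `2 [φ(-, D_c), D_c] = 0`.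
      have h := hφ.2.1 1 1 _ hu1 _ hv1 (lin hn ht (bar c))
      rw [shoBracket_lin_lin, map_zero, shoBracket_swap hv1 hA1] at h
      refine (smul_eq_zero.1 ?_).resolve_left h2F
      rw [two_smul]
      have h2 : (1 + 1 : ZMod 2) = 0 := by decide
      simpa [h2, sgn_zero, sgn_one] using h.symm
    · exact commute_lin_of_ne hn ht h2F hφ hce hdc hd
  intro d
  by_cases hd : d = bar e
  · subst hd
    obtain ⟨-, f, -, hf⟩ := SHO_le (φ (quadratic hn ht hce) (lin hn ht (bar c))).2
    refine shoBracket_eq_zero_comm (lin_mem hn ht _) hA1 (Subtype.ext ?_)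
    change bracket F n (linField F (bar e)) (φ _ _).1 = 0
    have hA2 : (φ (quadratic hn ht hce) (lin hn ht (bar c))).1 ∈ witPart F n (1 + 1 + 1) := hA1
    rw [← hf] at hA2 ⊢
    refine bracket_linField_eq_zero_of_ne h2F hA2 (by rw [tau_bar, he]; decide) fun d hd => ?_
    rw [hf]
    exact congrArg Subtype.val (shoBracket_eq_zero_comm hA1 (lin_mem hn ht d) (hne d hd))
  · exact hne d hd

theorem commute_lin {a b : ZMod 2} {x y : SHO F n p t} (hx : x ∈ shoPart F n p t a)
    (hy : y ∈ shoPart F n p t b) (e : Idx n) :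
    shoBracket F n p t (φ x y) (lin hn ht e) = 0 := by
  rcases zmod2_eq_zero_or_one (tau e) with he | he
  swap
  · exact commute_lin_odd hn ht h2F hφ hx hy he
  obtain ⟨c, hc, -, hce⟩ := exists_independent hn e e 0
  have hu := quadratic_mem (F := F) (p := p) hn ht hce
  have hv := lin_mem (F := F) (p := p) hn ht (bar c)
  refine commute_of_biderivation_eq_zero h2F hφ hx hy hv hu ?_ (sgn_ne_zero _)
    (shoBracket_lin_quadratic hn ht hce)
  suffices h : φ (quadratic hn ht hce) (lin hn ht (bar c)) = 0 by
    rw [biderivation_swap hφ hv hu, h, smul_zero]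
  refine biderivation_quadratic_lin_of_commute hn ht h2F hφ hce (hc.trans he.symm) fun d => ?_
  rcases zmod2_eq_zero_or_one (tau d) with hd | hd
  · exact commute_lin_of_ne hn ht h2F hφ hce (tau_bar_ne (hd.trans hc.symm))
      (tau_bar_ne (hd.trans he.symm))
  · exact commute_lin_odd hn ht h2F hφ hu hv hd

/-- The value is an even constant field, a combination of `T_H(x_e)` with `e` odd, and it commutes
with enough fields `T_H(x_{e'} x_d)`, `d` even, to make all coefficients vanish. -/
theorem biderivation_quadratic_eq_zero {a b c : Idx n} (hab : Independent a b)
    (hbc : Independent b c) (hac : Independent a c) (ha : tau a = 0) (hb : tau b = 0)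
    (hc : tau c = 0) :
    φ (quadratic hn ht hab) (quadratic hn ht hbc.bar_left) = 0 := by
  have hu := quadratic_mem (F := F) (p := p) hn ht hab
  have hw := quadratic_mem (F := F) (p := p) hn ht hbc.bar_left
  refine eq_zero_of_commute hn ht (hφ.1 _ _ _ hu _ hw) (commute_lin hn ht h2F hφ hu hw)
    fun e he => ?_
  have he' : tau (bar e) = 0 := by
    rw [tau_bar, he, ha, hb, tau_bar, hb, hc]; decide
  have hcomm : ∀ {d f : Idx n} (hdf : Independent d f), tau d = 0 → tau f = 0 →
      shoBracket F n p t (quadratic hn ht hab) (quadratic hn ht hdf) = 0 := fun hdf hd hf =>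
    shoBracket_quadratic_of_ne hn ht hab hdf (tau_bar_ne (hd.trans ha.symm))
      (tau_bar_ne (hd.trans hb.symm)) (tau_bar_ne (hf.trans ha.symm))
      (tau_bar_ne (hf.trans hb.symm))
  by_cases h : bar e = a ∨ bar e = b
  · refine ⟨a, b, hab, h, commute_biderivation hn ht h2F hφ hu hw hu (hcomm hab ha hb) ?_⟩
    rw [shoBracket_swap hw hu, shoBracket_quadratic hn ht hab hbc hac, map_smul, map_smul,
      hcomm hac ha hc, smul_zero, smul_zero]
  · push Not at h
    have hea : Independent (bar e) a := ⟨h.1, tau_bar_ne (ha.trans he'.symm)⟩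
    refine ⟨bar e, a, hea, Or.inl rfl,
      commute_biderivation hn ht h2F hφ hu hw (quadratic_mem hn ht hea) (hcomm hea he' ha) ?_⟩
    rw [shoBracket_quadratic_of_ne hn ht hbc.bar_left hea (by rw [bar_bar]; exact h.2)
      (tau_bar_ne (he'.trans hc.symm)) (by rw [bar_bar]; exact hab.1)
      (tau_bar_ne (ha.trans hc.symm)), map_zero]

theorem commute_quadratic_even {a b : ZMod 2} {x y : SHO F n p t} (hx : x ∈ shoPart F n p t a)
    (hy : y ∈ shoPart F n p t b) {c d : Idx n} (hcd : Independent c d) (hc : tau c = 0)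
    (hd : tau d = 0) : shoBracket F n p t (φ x y) (quadratic hn ht hcd) = 0 := by
  obtain ⟨e, he, hce, hed⟩ := exists_independent hn c d 0
  exact commute_of_biderivation_eq_zero h2F hφ hx hy (quadratic_mem hn ht hce)
    (quadratic_mem hn ht hed.bar_left)
    (biderivation_quadratic_eq_zero hn ht h2F hφ hce hed hcd hc he hd) (sgn_ne_zero _)
    (shoBracket_quadratic hn ht hce hed hcd)

/-- Even values of `φ` are combinations of the `T_H(x_c)` with `c` odd, whose coefficients vanish
because of the commutation with `T_H(x_{c'} x_d)`, `d` even. -/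
theorem biderivation_eq_zero_of_even {a b : ZMod 2} {x y : SHO F n p t}
    (hx : x ∈ shoPart F n p t a) (hy : y ∈ shoPart F n p t b) (hab : a + b + 1 = 0) :
    φ x y = 0 := by
  refine eq_zero_of_commute hn ht (hφ.1 a b x hx y hy) (commute_lin hn ht h2F hφ hx hy)
    fun c hc => ?_
  have hc' : tau (bar c) = 0 := by rw [tau_bar, hc, hab]
  obtain ⟨d, hd, hcd, -⟩ := exists_independent hn (bar c) (bar c) 0
  exact ⟨bar c, d, hcd, Or.inl rfl, commute_quadratic_even hn ht h2F hφ hx hy hcd hc' hd⟩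

/-- An odd skew-symmetric super-biderivation of `SHO(n,n;t)` vanishes on homogeneous elements. -/
theorem odd_biderivation_eq_zero {a b : ZMod 2} {x y : SHO F n p t}
    (hx : x ∈ shoPart F n p t a) (hy : y ∈ shoPart F n p t b) : φ x y = 0 := by
  rcases zmod2_eq_zero_or_one (a + b + 1) with hab | hab
  · exact biderivation_eq_zero_of_even hn ht h2F hφ hx hy hab
  refine eq_zero_of_commute hn ht (hφ.1 a b x hx y hy) (commute_lin hn ht h2F hφ hx hy)
    fun c hc => ?_
  have hc' : tau (bar c) = 1 := by rw [tau_bar, hc, hab]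
  obtain ⟨d, hd, hcd, -⟩ := exists_independent hn (bar c) (bar c) 1
  obtain ⟨e, he, hce, hed⟩ := exists_independent hn (bar c) d 1
  have hu := quadratic_mem (F := F) (p := p) hn ht hce
  have hw := quadratic_mem (F := F) (p := p) hn ht hed.bar_left
  refine ⟨bar c, d, hcd, Or.inl rfl, commute_of_biderivation_eq_zero h2F hφ hx hy hu hw
    (biderivation_eq_zero_of_even hn ht h2F hφ hu hw ?_) (sgn_ne_zero _)
    (shoBracket_quadratic hn ht hce hed hcd)⟩
  rw [hc', he, tau_bar, he, hd]
  decide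

end vanishing

end OddHam

end

/-- Every `ℤ/2`-homogeneous skew-symmetric super-biderivation of `SHO(n,n;t)` is even, and every
skew-symmetric super-biderivation of `SHO(n,n;t)` is `ℤ/2`-homogeneous, and in fact even. -/
theorem corollary4p6 {F : Type*} [Field F] [IsAlgClosed F] (p : ℕ) [Fact p.Prime] [CharP F p]
    (hp : 2 < p) (n : ℕ) (hn : 3 ≤ n) (t : Fin n → ℕ) (ht : ∀ i, 0 < t i) :
    (∀ γ : ZMod 2,
      ∀ φ ∈ OddHam.BDerOfDegree (OddHam.shoPart F n p t) (OddHam.shoBracket F n p t) γ,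
        OddHam.IsHomogeneousOfDegree (L := OddHam.SHO F n p t) (OddHam.shoPart F n p t) 0 φ) ∧
    (∀ φ ∈ OddHam.BDer (OddHam.shoPart F n p t) (OddHam.shoBracket F n p t),
      (∃ γ : ZMod 2, OddHam.IsHomogeneousOfDegree (L := OddHam.SHO F n p t)
          (OddHam.shoPart F n p t) γ φ) ∧
        OddHam.IsHomogeneousOfDegree (L := OddHam.SHO F n p t) (OddHam.shoPart F n p t) 0 φ) := by
  have h2F : (2 : F) ≠ 0 := by
    have h : ((2 : ℕ) : F) ≠ 0 := fun h0 =>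
      absurd (Nat.le_of_dvd two_pos ((CharP.cast_eq_zero_iff F p 2).1 h0)) (not_le.2 hp)
    exact_mod_cast h
  have hom : ∀ γ : ZMod 2,
      ∀ φ ∈ OddHam.BDerOfDegree (OddHam.shoPart F n p t) (OddHam.shoBracket F n p t) γ,
        OddHam.IsHomogeneousOfDegree (L := OddHam.SHO F n p t) (OddHam.shoPart F n p t) 0 φ := by
    intro γ φ hφ
    rcases OddHam.zmod2_eq_zero_or_one γ with rfl | rfl
    · exact hφ.1
    · intro a b x hx y hy
      rw [OddHam.odd_biderivation_eq_zero hn ht h2F hφ hx hy]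
      exact Submodule.zero_mem _
  have even : ∀ φ ∈ OddHam.BDer (OddHam.shoPart F n p t) (OddHam.shoBracket F n p t),
      OddHam.IsHomogeneousOfDegree (L := OddHam.SHO F n p t) (OddHam.shoPart F n p t) 0 φ := by
    intro φ hφ
    obtain ⟨φ₀, h₀, φ₁, h₁, rfl⟩ := Submodule.mem_sup.1 hφ
    intro a b x hx y hy
    exact Submodule.add_mem _ (hom 0 φ₀ h₀ a b x hx y hy) (hom 1 φ₁ h₁ a b x hx y hy)
  exact ⟨hom, fun φ hφ => ⟨⟨0, even φ hφ⟩, even φ hφ⟩⟩
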